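/- Let $q$ be a prime power, $K=\mathbb F_q(X)$, and let $G=\mathbb Z/r_1\mathbb Z\times\dots\times\mathbb Z/r_n\mathbb Z$ with $r_j\mid r_{j+1}$ and $q\equiv 1 \pmod{r_j}$ for all $j$ (equivalently $q\equiv 1\pmod{\exp(G)}$). Let $\mathcal R$ be the set of integer vectors $\vec\alpha=(\alpha_1,\dots,\alpha_n)\neq\vec 0$ with $0\le\alpha_j\le r_j-1$, and let $d(\vec\alpha)\ge 0$ $(\vec\alpha\in\mathcal R)$ be integers with $\sum_{\vec\alpha\in\mathcal R}\alpha_j d(\vec\alpha)\equiv 0\pmod{r_j}$ for all $j$. Let $\vec c=(c_1,\dots,c_n)\in(\mathbb F_q^*)^n$, and let $(f_{\vec\alpha})_{\vec\alpha\in\mathcal R}$ be monic, squarefree, pairwise coprime polynomials in $\mathbb F_q[X]$ such that either $\deg f_{\vec\alpha}=d(\vec\alpha)$ for all $\vec\alpha$, or, for some $\vec\beta\in\mathcal R$, $\deg f_{\vec\beta}=d(\vec\beta)-1$ and $\deg f_{\vec\alpha}=d(\vec\alpha)$ for all $\vec\alpha\ne\vec\beta$. Put $F_j=c_j\prod_{\vec\alpha\in\mathcal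 R}f_{\vec\alpha}^{\alpha_j}$. Let $C$ be the smooth projective curve over $\mathbb F_q$ corresponding to $(\vec c,(f_{\vec\alpha}))$, that is, with function field $K(C)=K(\sqrt[r_1]{F_1},\dots,\sqrt[r_n]{F_n})$, and suppose that $K(C)/K$ is Galois with $\mathrm{Gal}(K(C)/K)\cong G$. Let $\#C(\mathbb P^1(\mathbb F_q))$ denote the number of $\mathbb F_q$-rational points of $C$, i.e. of primes of $K(C)$ whose residue field is $\mathbb F_q$. Let $\mathcal S$ be the set of vectors $\vec s=(s_1,\dots,s_n)$ of positive integers with $s_j\mid r_j$, let $\ell(\vec s)=\mathrm{lcm}(s_1,\dots,s_n)$, and let $\Omega_{\vec s}$ be the set of integer vectors $\vec\omega$ with $1\le\omega_j\le s_j$ and $(\omega_j,s_j)=1$. For $\vec s\in\mathcal S$, $\vec\omega\in\Omega_{\vec s}$ put $$c_{(\vec s)}^{(\vec\omega)}=\prod_{j=1}^n c_j^{\frac{\ell(\vec s)}{s_j}\omega_j \bmod \ell(\vec s)},\qquad F_{(\vec s)}^{(\vec\omega)}(X)=c_{(\vec s)}^{(\vec\omega)}\prod_{\vec\alpha\in\mathcal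 R}f_{\vec\alpha}(X)^{\sum_{j=1}^n\frac{\ell(\vec s)}{s_j}\omega_j\alpha_j \bmod \ell(\vec s)},$$ where $*\bmod \ell(\vec s)$ in an exponent is the smallest non-negative residue and $f^0=1$. At the point $\infty$ of $\mathbb P^1(\mathbb F_q)$ put $F_{(\vec s)}^{(\vec\omega)}(\infty)=c_{(\vec s)}^{(\vec\omega)}$ if $\sum_{j=1}^n\frac{\ell(\vec s)}{s_j}\omega_j\deg F_j\equiv 0\pmod{\ell(\vec s)}$, and $F_{(\vec s)}^{(\vec\omega)}(\infty)=0$ otherwise. For each $m$ dividing $\exp(G)$ let $\chi_m:\mathbb F_q^*\to\mathbb C^*$ be a multiplicative character of order $m$, extended by $\chi_m(0)=0$. Then $$\#C(\mathbb P^1(\mathbb F_q))=\sum_{x\in\mathbb P^1(\mathbb F_q)}\ \sum_{\vec s\in\mathcal S}\ \sum_{\vec\omega\in\Omega_{\vec s}}\chi_{\ell(\vec s)}\bigl(F_{(\vec s)}^{(\vec\omega)}(x)\bigr).$$ -/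

import Mathlib

open Polynomial

namespace AbelianCover

/-! ### Points of the smooth projective curve with a given function field

The smooth projective curve `C` over `k` with function field `L` is the set of all discrete
valuation rings of `L` that contain `k` (the abstract nonsingular curve of `L / k`, whose points are
the primes of `L`).  A point of `C` is `k`-rational when its residue field is `k`. -/

/-- `V` is a (closed) point of the smooth projective curve over `k` with function field `L`:
a discrete valuation ring of `L` (its fraction field is `L`) that contains the constants `k`. -/
structure IsCurvePoint (k : Type*) {L : Type*} [Field k] [Field L] [Algebra k L]
    (V : ValuationSubring L) : Prop where
  const_mem : ∀ a : k, algebraMap k L a ∈ V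
  dvr : IsDiscreteValuationRing V

/-- The map `k → V / 𝔪_V` from the constants to the residue field at a point. -/
noncomputable def IsCurvePoint.toResidueField {k L : Type*} [Field k] [Field L] [Algebra k L]
    {V : ValuationSubring L} (h : IsCurvePoint k V) : k →+* IsLocalRing.ResidueField V :=
  (IsLocalRing.residue V).comp ((algebraMap k L).codRestrict V.toSubring h.const_mem)

/-- The set `C(k)` of `k`-rational points of the smooth projective curve `C` over `k` with function
field `L`: the points whose residue field is `k` (the primes of degree one). -/
def rationalPoints (k L : Type*) [Field k] [Field L] [Algebra k L] : Set (ValuationSubring L) :=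
  {V | ∃ h : IsCurvePoint k V, Function.Bijective h.toResidueField}

/-! ### Tuples of polynomials -/

/-- The index set `𝓡`: integer vectors `α` with `0 ≤ α_j ≤ r_j - 1`, not all entries zero. -/
abbrev IndexSet {n : ℕ} (r : Fin n → ℕ) : Type :=
  {α : (j : Fin n) → Fin (r j) // ∃ j, (α j : ℕ) ≠ 0}

section Tuples

variable {F : Type*} [Field F] {n : ℕ} {r : Fin n → ℕ}

/-- Tuples of monic, squarefree, pairwise coprime polynomials. -/
def IsAdmissibleTuple (f : IndexSet r → F[X]) : Prop :=
  (∀ α, (f α).Monic ∧ Squarefree (f α)) ∧ ∀ α β, α ≠ β → IsCoprime (f α) (f β)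

/-- `𝓕_d`: the admissible tuples with `deg f_α = d(α)` for all `α`. -/
def tuples (F : Type*) [Field F] {n : ℕ} {r : Fin n → ℕ} (d : IndexSet r → ℕ) :
    Set (IndexSet r → F[X]) :=
  {f | IsAdmissibleTuple f ∧ ∀ α, (f α).natDegree = d α}

/-- `𝓕_d^β`: the admissible tuples with `deg f_β = d(β) - 1` (an equation of integers, so that
there are none if `d(β) = 0`) and `deg f_α = d(α)` for all `α ≠ β`. -/
def tuplesDrop (F : Type*) [Field F] {n : ℕ} {r : Fin n → ℕ} (d : IndexSet r → ℕ)
    (β : IndexSet r) : Set (IndexSet r → F[X]) :=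
  {f | IsAdmissibleTuple f ∧ (f β).natDegree + 1 = d β ∧ ∀ α, α ≠ β → (f α).natDegree = d α}

/-- `𝓕_[d]`, the union of `𝓕_d` and of all `𝓕_d^β`. -/
def tuplesBracket (F : Type*) [Field F] {n : ℕ} {r : Fin n → ℕ} (d : IndexSet r → ℕ) :
    Set (IndexSet r → F[X]) :=
  tuples F d ∪ ⋃ β, tuplesDrop F d β

/-- The Kummer generator `F_j = c_j ∏_α f_α ^ α_j`. -/
noncomputable def kummerPoly (c : Fin n → Fˣ) (f : IndexSet r → F[X]) (j : Fin n) : F[X] :=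
  C (c j : F) * ∏ α : IndexSet r, f α ^ (α.1 j : ℕ)

/-- The curve with function field `L` over `K = F(X)` is Galois over the line with group
`G = ∏ ℤ/r_j` and corresponds to `(c, (f_α))`:
`Gal(L/K) ≅ G` and `L = K(F_1 ^ (1/r_1), …, F_n ^ (1/r_n))`. -/
structure CorrespondsTo (L : Type*) [Field L] [Algebra (RatFunc F) L]
    (c : Fin n → Fˣ) (f : IndexSet r → F[X]) : Prop where
  isGalois : IsGalois (RatFunc F) L
  galEquiv : Nonempty ((L ≃ₐ[RatFunc F] L) ≃* Multiplicative ((j : Fin n) → ZMod (r j)))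
  generators : ∃ y : Fin n → L,
    (∀ j, y j ^ r j = algebraMap (RatFunc F) L (algebraMap F[X] (RatFunc F) (kummerPoly c f j))) ∧
    IntermediateField.adjoin (RatFunc F) (Set.range y) = ⊤

end Tuples

/-! ### The polynomials `F_(s)^(ω)` and their values on the projective line -/

/-- `𝓢`: the vectors `s` of positive integers with `s_j ∣ r_j`. -/
def divisorVectors {n : ℕ} (r : Fin n → ℕ) : Finset (Fin n → ℕ) :=
  Fintype.piFinset fun j => (r j).divisors

/-- `ℓ(s) = lcm(s_1, …, s_n)`. -/
def ell {n : ℕ} (s : Fin n → ℕ) : ℕ := Finset.univ.lcm s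

/-- `Ω_s`: the vectors `ω` with `1 ≤ ω_j ≤ s_j` and `(ω_j, s_j) = 1`. -/
def Omega {n : ℕ} (s : Fin n → ℕ) : Finset (Fin n → ℕ) :=
  Fintype.piFinset fun j => (Finset.Icc 1 (s j)).filter fun w => Nat.Coprime w (s j)

section Values

variable {F : Type*} [Field F] {n : ℕ} {r : Fin n → ℕ}

/-- `c_(s)^(ω) = ∏_j c_j ^ ((ℓ(s)/s_j) ω_j mod ℓ(s))`. -/
def leadCoeff (c : Fin n → Fˣ) (s ω : Fin n → ℕ) : F :=
  ∏ j, (c j : F) ^ ((ell s / s j * ω j) % ell s)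

/-- `F_(s)^(ω) = c_(s)^(ω) ∏_α f_α ^ (∑_j (ℓ(s)/s_j) ω_j α_j mod ℓ(s))`. -/
noncomputable def twistedPoly (c : Fin n → Fˣ) (f : IndexSet r → F[X]) (s ω : Fin n → ℕ) : F[X] :=
  C (leadCoeff c s ω) *
    ∏ α : IndexSet r, f α ^ ((∑ j, ell s / s j * ω j * (α.1 j : ℕ)) % ell s)

/-- The value `F_(s)^(ω)(x)` for `x` in the projective line `F ∪ {∞}`.  At a finite point it is the
value of the polynomial.  At infinity, with `d_j = deg F_j`, it is `c_(s)^(ω)` if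
`∑_j (ℓ(s)/s_j) ω_j d_j ≡ 0 mod ℓ(s)`, and `0` otherwise. -/
noncomputable def twistedValue (c : Fin n → Fˣ) (f : IndexSet r → F[X]) (s ω : Fin n → ℕ) :
    OnePoint F → F
  | OnePoint.some x => (twistedPoly c f s ω).eval x
  | OnePoint.infty =>
      if ell s ∣ ∑ j, ell s / s j * ω j * (kummerPoly c f j).natDegree then leadCoeff c s ω else 0

end Values

end AbelianCover

/-! The count goes fibre by fibre over `x ∈ ℙ¹(F)`. Put `N = ℓ(r)`. With a uniformizer `t` at `x`,
write `y_j ^ r_j = t ^ k_j * g_j`, where `g_j` is a unit with residue `b_j`. The map `orderHom`, `e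
↦ ∑ (N / r_j) e_j k_j mod N`, measures the order of `y^e` at `x` in units of `1 / N`, modulo
integers. For `e` in its kernel some `y^e t^(-m)` is a unit, and its `N`-th power has residue `β(e)
= ∏ b_j ^ ((N / r_j) e_j)`.

The fibre has `|ker|` rational points if every `β(e)` with `e ∈ ker` is an `N`-th power in `F`, and
none otherwise (`IsLocalKummer.ncard_rationalZeros`). Necessity: reduce these units at a rational
point. Sufficiency: the units then have residues in `F` at every prime above `x`. As the degree is
the full `∏ r_j`, Galois realizes every character of `∏ ℤ/r_j`, and the characters of `ker` move one
prime to `|ker|` different ones. A ramification index kills the range of `orderHom`, a subgroup of a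
cyclic group, so it is at least `|range|`. Since `∑ e f = ∏ r_j = |ker| |range|`, all these bounds
are equalities and every `f` is `1`.

On the character side, `(s, ω)` enumerates `∏ ℤ/r_j`, and the summand at `x` becomes `ψ(β(e))` on
`ker` and `0` off it, with `ψ = χ_N`. As `ψ(a) = 1` exactly for `N`-th powers `a`, orthogonality on
`ker` gives the same number (`sum_mulChar_eq`). The `χ_m` are chosen independently of one another,
so they are powers of `ψ` only up to multipliers prime to `m`; these merely change the enumeration.
-/

namespace AbelianCover

/-! ### Homomorphisms out of `∏ ℤ/r_j`, and two counting bounds. -/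

section PiHom

variable {ι : Type*} [Fintype ι] {r : ι → ℕ} {M : Type*} [AddCommGroup M]

/-- The homomorphism `∏ ℤ/r_j → M`, `e ↦ ∑ e_j a_j`, for elements `a_j` killed by `r_j`. -/
noncomputable def piHom (a : ι → M) (ha : ∀ j, r j • a j = 0) : ((j : ι) → ZMod (r j)) →+ M :=
  ∑ j, (ZMod.lift (r j) ⟨zmultiplesHom M (a j), by simpa using ha j⟩).comp
    (Pi.evalAddMonoidHom _ j)

theorem piHom_natCast (a : ι → M) (ha : ∀ j, r j • a j = 0) (m : ι → ℕ) :
    piHom a ha (fun j => (m j : ZMod (r j))) = ∑ j, m j • a j := by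
  simp only [piHom, AddMonoidHom.finsetSum_apply, AddMonoidHom.comp_apply,
    Pi.evalAddMonoidHom_apply]
  refine Finset.sum_congr rfl fun j _ => ?_
  have := ZMod.lift_coe (r j) ⟨zmultiplesHom M (a j), by simpa using ha j⟩ (m j : ℤ)
  simpa using this

end PiHom

/-- The `m`-torsion of `ℤ/N` has at most `m` elements. -/
theorem card_addSubgroup_le_of_nsmul_eq_zero {N m : ℕ} [NeZero N] (hm : 0 < m)
    (H : AddSubgroup (ZMod N)) (h : ∀ x ∈ H, m • x = 0) : Nat.card H ≤ m := by
  classical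
  refine le_trans ?_ (IsAddCyclic.card_nsmul_eq_zero_le (α := ZMod N) hm)
  rw [← Nat.card_eq_finsetCard]
  exact Nat.card_le_card_of_injective
    (fun x : H => (⟨x.1, by simpa using h x.1 x.2⟩ :
      {a // a ∈ Finset.univ.filter fun a : ZMod N => m • a = 0}))
    (fun x y hxy => Subtype.ext (by simpa using hxy))

/-- If `∑ e f = u M` with all `e ≥ M` and at least `u` primes, then there are exactly `u` primes
and all inertia degrees are `1`. -/
theorem primesOver_of_ramification_bound {A B : Type*} [CommRing A] [IsDomain A] [CommRing B]
    [Algebra A B] [Module.Finite A B] [Module.Flat A B] (p : Ideal A) [p.IsPrime]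
    [Finite (p.primesOver B)] {u M : ℕ} (hM : 0 < M) (h : Module.finrank A B = u * M)
    (he : ∀ P ∈ p.primesOver B, M ≤ P.ramificationIdx A)
    (hu : u ≤ (p.primesOver B).ncard) :
    (p.primesOver B).ncard = u ∧ ∀ P ∈ p.primesOver B, P.inertiaDeg A = 1 := by
  classical
  have := Fintype.ofFinite (p.primesOver B)
  have hsum := Ideal.sum_ramification_inertia_eq_finrank p B
  have hle : ∀ q : p.primesOver B, M ≤ q.1.ramificationIdx A * q.1.inertiaDeg A := fun q => by
    have := q.2.1
    exact le_trans (he q q.2) (Nat.le_mul_of_pos_right _ (Ideal.inertiaDeg_pos _ _))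
  have hcard : (p.primesOver B).ncard = Fintype.card (p.primesOver B) := by
    rw [← Nat.card_coe_set_eq, Nat.card_eq_fintype_card]
  have h1 : (p.primesOver B).ncard * M ≤ u * M := by
    rw [← h, ← hsum, hcard, ← smul_eq_mul]
    exact Finset.card_nsmul_le_sum _ _ _ fun q _ => hle q
  have h2 : (p.primesOver B).ncard = u := le_antisymm (Nat.le_of_mul_le_mul_right h1 hM) hu
  refine ⟨h2, fun P hP => ?_⟩
  have hP' := hP.1
  -- Equal sums with `M ≤ e f` termwise force `e f = M` for each prime; then `M ≤ e` leaves only `f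
  -- = 1`.
  have heq : ∑ q : p.primesOver B, M = ∑ q : p.primesOver B,
      q.1.ramificationIdx A * q.1.inertiaDeg A := by
    rw [hsum, h, ← h2, hcard]; simp
  have h3 := (Finset.sum_eq_sum_iff_of_le fun q _ => hle q).1 heq ⟨P, hP⟩ (Finset.mem_univ _)
  have h4 := he P hP
  have h5 : 0 < P.inertiaDeg A := Ideal.inertiaDeg_pos _ _
  simp only at h3
  nlinarith

/-! ### The Galois group of a Kummer extension of full degree. -/

section Kummer

variable {F K L : Type*} [Field F] [Field K] [Field L] [Algebra K L] [Algebra F L]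
  {ι : Type*} [Fintype ι] {r : ι → ℕ}

/-- In a Kummer extension of full degree `∏ r_j`, every choice of roots of unity is realized by an
automorphism. -/
theorem exists_algEquiv_of_rootsOfUnity {N : ℕ} [NeZero N] [HasEnoughRootsOfUnity F N]
    (hr : ∀ j, r j ∣ N) [FiniteDimensional K L]
    (hcard : Nat.card (L ≃ₐ[K] L) = ∏ j, r j) (y : ι → L) (a : ι → K)
    (hy0 : ∀ j, y j ≠ 0) (hy : ∀ j, y j ^ r j = algebraMap K L (a j))
    (hgen : IntermediateField.adjoin K (Set.range y) = ⊤)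
    (ζ : ι → Fˣ) (hζ : ∀ j, ζ j ^ r j = 1) :
    ∃ σ : L ≃ₐ[K] L, ∀ j, σ (y j) = algebraMap F L (ζ j) * y j := by
  have hr0 : ∀ j, NeZero (r j) := fun j => ⟨fun h => NeZero.ne N (by simpa [h] using hr j)⟩
  have key : ∀ (σ : L ≃ₐ[K] L) (j : ι), ∃ z : rootsOfUnity (r j) F,
      σ (y j) = algebraMap F L ((z : Fˣ) : F) * y j := by
    intro σ j
    have := HasEnoughRootsOfUnity.of_dvd F (hr j)
    obtain ⟨ξ, hξ⟩ := HasEnoughRootsOfUnity.exists_primitiveRoot F (r j)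
    have hξL : IsPrimitiveRoot (algebraMap F L ξ) (r j) :=
      hξ.map_of_injective (algebraMap F L).injective
    -- The ratio is an `r j`-th root of unity of `L`; all of these already lie in `F`.
    have h1 : (σ (y j) / y j) ^ r j = 1 := by
      rw [div_pow, ← map_pow, hy, AlgEquiv.commutes, ← hy, div_self (pow_ne_zero _ (hy0 j))]
    obtain ⟨i, -, hi⟩ := hξL.eq_pow_of_pow_eq_one h1
    have hu : IsUnit ξ := hξ.isUnit (NeZero.ne _)
    refine ⟨⟨hu.unit ^ i, ?_⟩, ?_⟩
    · rw [mem_rootsOfUnity]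
      ext
      simp only [Units.val_pow_eq_pow_val, IsUnit.unit_spec, Units.val_one]
      rw [← pow_mul, mul_comm, pow_mul, hξ.pow_eq_one, one_pow]
    · rw [eq_comm, ← eq_div_iff (hy0 j), ← hi]
      simp
  choose z hz using key
  -- An automorphism is determined on the generators, and both sides have `∏ r j` elements, so
  -- injectivity gives surjectivity.
  have hinj : Function.Injective z := by
    intro σ τ h
    ext x
    have hx : x ∈ IntermediateField.adjoin K (Set.range y) := hgen ▸ IntermediateField.mem_top
    induction hx using IntermediateField.adjoin_induction with
    | mem x hx =>
      obtain ⟨j, rfl⟩ := hx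
      rw [hz, hz, h]
    | algebraMap x => simp
    | add x w _ _ hx hw => rw [map_add, map_add, hx, hw]
    | inv x _ hx => rw [map_inv₀, map_inv₀, hx]
    | mul x w _ _ hx hw => rw [map_mul, map_mul, hx, hw]
  have hfin : ∀ j, Nat.card (rootsOfUnity (r j) F) = r j := fun j => by
    have := HasEnoughRootsOfUnity.of_dvd F (hr j)
    rw [HasEnoughRootsOfUnity.natCard_rootsOfUnity]
  have hfin' : ∀ j, Finite (rootsOfUnity (r j) F) := fun j =>
    Nat.finite_of_card_ne_zero (by rw [hfin j]; exact NeZero.ne _)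
  have hbij : Function.Bijective z :=
    (Nat.bijective_iff_injective_and_card z).2 ⟨hinj, by 
      rw [hcard, Nat.card_pi]; exact (Finset.prod_congr rfl fun j _ => hfin j).symm⟩
  obtain ⟨σ, hσ⟩ := hbij.2 fun j => ⟨ζ j, hζ j⟩
  exact ⟨σ, fun j => by rw [hz, hσ]⟩

end Kummer

/-! ### Orders of monomials and local Kummer data at a place. -/

section OrderHom

variable {ι : Type*} [Fintype ι] {r : ι → ℕ} {N : ℕ}

/-- For generators of orders `k_j / r_j` at a place, `N` times the order of the monomial with
exponent vector `e`, modulo `N`. -/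
noncomputable def orderHom (hr : ∀ j, r j ∣ N) (k : ι → ℤ) :
    ((j : ι) → ZMod (r j)) →+ ZMod N :=
  piHom (fun j => ((N / r j : ℕ) : ZMod N) * (k j : ZMod N)) fun j => by
    rw [nsmul_eq_mul, ← mul_assoc, ← Nat.cast_mul, Nat.mul_div_cancel' (hr j)]
    simp

theorem orderHom_natCast (hr : ∀ j, r j ∣ N) (k : ι → ℤ) (m : ι → ℕ) :
    orderHom hr k (fun j => (m j : ZMod (r j))) =
      ((∑ j, ((N / r j * m j : ℕ) : ℤ) * k j : ℤ) : ZMod N) := by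
  rw [orderHom, piHom_natCast]
  rw [Int.cast_sum]
  refine Finset.sum_congr rfl fun j _ => ?_
  rw [nsmul_eq_mul, Int.cast_mul, Int.cast_natCast, Nat.cast_mul]
  ring

theorem orderHom_apply [∀ j, NeZero (r j)] (hr : ∀ j, r j ∣ N) (k : ι → ℤ)
    (e : (j : ι) → ZMod (r j)) :
    orderHom hr k e = ((∑ j, ((N / r j * (e j).val : ℕ) : ℤ) * k j : ℤ) : ZMod N) := by
  rw [← orderHom_natCast hr]
  congr 1
  funext j
  simp

end OrderHom

/-- Local data of a Kummer extension at a place with residue field `F`: the `r_j`-th power of the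
generator `y_j` is `ϖ ^ k_j g_j`, where `ϖ` is a uniformizer and `g_j` a unit with residue `b_j`. -/
structure IsLocalKummer {F A L ι : Type*} [Field F] [CommRing A] [Field L] [Algebra F A]
    [Algebra A L] (ϖ : A) (r : ι → ℕ) (k : ι → ℤ) (g : ι → A) (b : ι → Fˣ) (y : ι → L) :
    Prop where
  prime : Prime ϖ
  residue : ∀ a : A, ∃ c : F, ϖ ∣ a - algebraMap F A c
  unit : ∀ j, ϖ ∣ g j - algebraMap F A (b j)
  root : ∀ j, y j ^ r j = algebraMap A L ϖ ^ k j * algebraMap A L (g j)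

namespace IsLocalKummer

variable {F A L ι : Type*} [Field F] [CommRing A] [Field L] [Algebra F A] [Algebra A L]
  [Fintype ι] {ϖ : A} {r : ι → ℕ} {k : ι → ℤ} {g : ι → A} {b : ι → Fˣ} {y : ι → L} {N : ℕ}

/-- Raising to a common multiple `N` of the `r j` clears all the roots at once, since `N * e j = r j
* (N / r j * e j)`. -/
theorem monomial_pow (h : IsLocalKummer ϖ r k g b y) (hϖ : algebraMap A L ϖ ≠ 0)
    (hr : ∀ j, r j ∣ N) (e : ι → ℕ) :
    (∏ j, y j ^ e j) ^ N = algebraMap A L ϖ ^ (∑ j, ((N / r j * e j : ℕ) : ℤ) * k j) *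
      algebraMap A L (∏ j, g j ^ (N / r j * e j)) := by
  have h1 : ∀ j, (y j ^ e j) ^ N = algebraMap A L ϖ ^ (((N / r j * e j : ℕ) : ℤ) * k j) *
      algebraMap A L (g j) ^ (N / r j * e j) := by
    intro j
    obtain ⟨m, hm⟩ := hr j
    -- If `r j = 0` then `N = 0` and both sides are `1`.
    rcases Nat.eq_zero_or_pos (r j) with h0 | h0
    · have : N = 0 := by simpa [h0] using hm
      simp [this]
    have h2 : N / r j = m := by rw [hm, Nat.mul_div_cancel_left _ h0]
    rw [h2, ← pow_mul, hm, show e j * (r j * m) = r j * (m * e j) by ring, pow_mul, h.root,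
      mul_pow, ← zpow_natCast (_ ^ k j), ← zpow_mul, mul_comm (k j)]
  rw [← Finset.prod_pow, Finset.prod_congr rfl fun j _ => h1 j, Finset.prod_mul_distrib, map_prod]
  simp only [map_pow]
  congr 1
  have h2 : ∀ s : Finset ι, ∏ j ∈ s, algebraMap A L ϖ ^ (((N / r j * e j : ℕ) : ℤ) * k j) =
      algebraMap A L ϖ ^ (∑ j ∈ s, ((N / r j * e j : ℕ) : ℤ) * k j) := by
    classical
    intro s
    induction s using Finset.induction_on with
    | empty => simp
    | insert a s ha ih => rw [Finset.prod_insert ha, Finset.sum_insert ha, zpow_add₀ hϖ, ih]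
  exact h2 _

/-- The unit `y^e ϖ^{-m}` attached to an unramified exponent vector `e`. -/
theorem unit_pow (h : IsLocalKummer ϖ r k g b y) (hϖ : algebraMap A L ϖ ≠ 0)
    (hr : ∀ j, r j ∣ N) (e : ι → ℕ) {m : ℤ} (hm : ∑ j, ((N / r j * e j : ℕ) : ℤ) * k j = N * m) :
    ((∏ j, y j ^ e j) * algebraMap A L ϖ ^ (-m)) ^ N =
      algebraMap A L (∏ j, g j ^ (N / r j * e j)) := by
  rw [mul_pow, h.monomial_pow hϖ hr, hm, ← zpow_natCast (_ ^ (-m)), ← zpow_mul, mul_right_comm,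
    ← zpow_add₀ hϖ]
  simp [mul_comm m]

theorem dvd_prod_sub (h : IsLocalKummer ϖ r k g b y) (c : ι → ℕ) :
    ϖ ∣ (∏ j, g j ^ c j) - algebraMap F A ((∏ j, b j ^ c j : Fˣ) : F) := by
  rw [← Ideal.mem_span_singleton, ← Ideal.Quotient.eq]
  have h1 : ∀ j, Ideal.Quotient.mk (Ideal.span {ϖ}) (g j) =
      Ideal.Quotient.mk (Ideal.span {ϖ}) (algebraMap F A (b j)) := fun j => by
    rw [Ideal.Quotient.eq, Ideal.mem_span_singleton]; exact h.unit j
  simp [h1]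

end IsLocalKummer

/-- An `N`-th root of a residue is a residue, in a domain over a field with enough roots of
unity. -/
theorem exists_eq_algebraMap_of_pow_eq {F R : Type*} [Field F] [CommRing R] [IsDomain R]
    [Algebra F R] {N : ℕ} [NeZero N] [HasEnoughRootsOfUnity F N] {z : R} {w : Fˣ}
    (h : z ^ N = algebraMap F R (w : F) ^ N) : ∃ w' : Fˣ, z = algebraMap F R (w' : F) := by
  obtain ⟨ξ, hξ⟩ := HasEnoughRootsOfUnity.exists_primitiveRoot F N
  have hξR : IsPrimitiveRoot (algebraMap F R ξ) N :=
    hξ.map_of_injective (algebraMap F R).injective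
  have h1 : (z * algebraMap F R ((w⁻¹ : Fˣ) : F)) ^ N = 1 := by
    rw [mul_pow, h, ← mul_pow, ← map_mul]
    simp
  obtain ⟨i, -, hi⟩ := hξR.eq_pow_of_pow_eq_one h1
  have hu : IsUnit ξ := hξ.isUnit (NeZero.ne _)
  refine ⟨hu.unit ^ i * w, ?_⟩
  simp only [Units.val_mul, Units.val_pow_eq_pow_val, IsUnit.unit_spec, map_mul, map_pow]
  rw [hi, mul_assoc, ← map_mul]
  simp

/-! ### Ramification, splitting and residue degrees above a place. -/

section Primes

variable {F A L ι : Type*} [Field F] [CommRing A] [Field L] [Algebra F A] [Algebra A L]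
  [Fintype ι] {ϖ : A} {r : ι → ℕ} {k : ι → ℤ} {g : ι → A} {b : ι → Fˣ} {y : ι → L} {N : ℕ}

theorem IsLocalKummer.notMem_of_mem (h : IsLocalKummer ϖ r k g b y) {B : Type*} [CommRing B]
    [Algebra A B] (P : Ideal B) [P.IsPrime] (hP : algebraMap A B ϖ ∈ P) (c : ι → ℕ) :
    algebraMap A B (∏ j, g j ^ c j) ∉ P := by
  let : Algebra F B := ((algebraMap A B).comp (algebraMap F A)).toAlgebra
  intro hmem
  obtain ⟨a, ha⟩ := h.dvd_prod_sub c
  have h2 : algebraMap A B (algebraMap F A ((∏ j, b j ^ c j : Fˣ) : F)) ∈ P := by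
    rw [← sub_sub_self (∏ j, g j ^ c j) (algebraMap F A _), ha, map_sub, map_mul]
    exact P.sub_mem hmem (P.mul_mem_right _ hP)
  exact (Ideal.IsPrime.ne_top ‹_›) (Ideal.eq_top_of_isUnit_mem _ h2
    (((∏ j, b j ^ c j : Fˣ).isUnit.map (algebraMap F A)).map (algebraMap A B)))

open IsDedekindDomain in
/-- The ramification index kills the order homomorphism. -/
theorem IsLocalKummer.nsmul_orderHom_eq_zero [NeZero N] (h : IsLocalKummer ϖ r k g b y)
    [∀ j, NeZero (r j)] (hr : ∀ j, r j ∣ N)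
    {B : Type*} [CommRing B] [IsDedekindDomain B] [Algebra A B] [Algebra B L]
    [IsFractionRing B L] [IsScalarTower A B L] (P : Ideal B) [P.IsPrime]
    (hϖ : algebraMap A L ϖ ≠ 0)
    (hP : algebraMap A B ϖ ∈ P) (e : (j : ι) → ZMod (r j)) :
    multiplicity P (Ideal.span {algebraMap A B ϖ}) • orderHom hr k e = 0 := by
  have hϖB : algebraMap A B ϖ ≠ 0 := fun h0 => hϖ (by
    rw [IsScalarTower.algebraMap_apply A B L, h0, map_zero])
  have hP0 : P ≠ ⊥ := fun h0 => hϖB (by simpa [h0] using hP)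
  let v : HeightOneSpectrum B := ⟨P, inferInstance, hP0⟩
  set m := multiplicity P (Ideal.span {algebraMap A B ϖ}) with hm
  have hv : v.valuation L (algebraMap A L ϖ) = WithZero.exp (-(m : ℤ)) := by
    rw [IsScalarTower.algebraMap_apply A B L, v.valuation_of_algebraMap,
      v.intValuation_eq_exp_neg_multiplicity hϖB]
  have h1 := congrArg (v.valuation L) (h.monomial_pow hϖ hr fun j => (e j).val)
  rw [map_pow, map_mul, map_zpow₀, hv, IsScalarTower.algebraMap_apply A B L (∏ j, _),
    (v.valuation_eq_one_iff_notMem (K := L)).2 (h.notMem_of_mem P hP _), mul_one] at h1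
  set s := ∑ j, ((N / r j * (e j).val : ℕ) : ℤ) * k j with hs
  set x := v.valuation L (∏ j, y j ^ (e j).val) with hx
  have hx0 : x ≠ 0 := fun h0 => by
    rw [h0, zero_pow (NeZero.ne N)] at h1
    exact zpow_ne_zero _ WithZero.exp_ne_zero h1.symm
  -- This reads `N * log x = -(m * s)`, so `N ∣ m * s`, where the integer `s` lifts the value of
  -- `orderHom`.
  have h2 := congrArg WithZero.log h1
  rw [WithZero.log_pow, WithZero.log_zpow, WithZero.log_exp, nsmul_eq_mul, smul_eq_mul] at h2
  rw [orderHom_apply, ← hs, nsmul_eq_mul, ← Int.cast_natCast (R := ZMod N) m, ← Int.cast_mul,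
    ZMod.intCast_zmod_eq_zero_iff_dvd]
  refine ⟨-WithZero.log x, ?_⟩
  linarith

end Primes

/-- The residue field `B ⧸ P` is one-dimensional over `A ⧸ p`, hence spanned by `1`. -/
theorem exists_sub_mem_of_inertiaDeg_eq_one {A B : Type*} [CommRing A] [CommRing B] [Algebra A B]
    (p : Ideal A) (P : Ideal B) [p.IsMaximal] [P.IsMaximal] [P.LiesOver p]
    (h : P.inertiaDeg A = 1) (x : B) : ∃ a : A, x - algebraMap A B a ∈ P := by
  rw [Ideal.inertiaDeg_eq_of_isMaximal p P] at h
  let : Field (A ⧸ p) := Ideal.Quotient.field p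
  obtain ⟨a, ha⟩ := (finrank_eq_one_iff_of_nonzero' (1 : B ⧸ P) one_ne_zero).1 h
    (Ideal.Quotient.mk P x)
  obtain ⟨a, rfl⟩ := Ideal.Quotient.mk_surjective a
  refine ⟨a, ?_⟩
  rw [← Ideal.Quotient.eq, ← ha]
  change Ideal.Quotient.mk p a • (1 : B ⧸ P) = _
  rw [Algebra.smul_def, mul_one, Ideal.Quotient.algebraMap_mk_of_liesOver]

theorem IsLocalKummer.root_ne_zero {F A L ι : Type*} [Field F] [CommRing A] [Field L]
    [Algebra F A] [Algebra A L] [FaithfulSMul A L] {ϖ : A} {r : ι → ℕ} {k : ι → ℤ} {g : ι → A}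
    {b : ι → Fˣ} {y : ι → L} (h : IsLocalKummer ϖ r k g b y) [∀ j, NeZero (r j)] (j : ι) :
    y j ≠ 0 := by
  intro h0
  have h1 := h.root j
  rw [h0, zero_pow (NeZero.ne _), eq_comm, mul_eq_zero] at h1
  rcases h1 with h1 | h1
  · refine zpow_ne_zero _ ?_ h1
    rw [Ne, FaithfulSMul.algebraMap_eq_zero_iff]
    exact h.prime.ne_zero
  · rw [FaithfulSMul.algebraMap_eq_zero_iff] at h1
    have h2 := h.unit j
    rw [h1, zero_sub, dvd_neg] at h2
    exact h.prime.not_isUnit (isUnit_of_dvd_unit h2 ((b j).isUnit.map (algebraMap F A)))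

section PrimesOver

variable {F A K L ι : Type*} [Field F] [CommRing A] [Field K] [Field L]
  [Algebra F A] [Algebra A K] [Algebra K L] [Algebra A L]
  [IsScalarTower A K L] [Algebra F L] [IsScalarTower F A L]
  [Fintype ι] {ϖ : A} {r : ι → ℕ} {k : ι → ℤ} {g : ι → A} {b : ι → Fˣ} {y : ι → L} {N : ℕ}

/-- The integral unit `y^e ϖ^{-m}` attached to an unramified exponent vector, its residue at any
prime above `ϖ`, and the Galois action on it. -/
theorem IsLocalKummer.exists_integral_unit [FaithfulSMul A L] [NeZero N]
    [HasEnoughRootsOfUnity F N] (h : IsLocalKummer ϖ r k g b y) (hr : ∀ j, r j ∣ N)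
    [∀ j, NeZero (r j)] {e : (j : ι) → ZMod (r j)} (he : e ∈ (orderHom hr k).ker)
    (hw : ∃ w : Fˣ, w ^ N = ∏ j, b j ^ (N / r j * (e j).val)) :
    ∃ z : integralClosure A L,
      (∀ P : Ideal (integralClosure A L), P.IsPrime → algebraMap A _ ϖ ∈ P →
        ∃ w : Fˣ, z - algebraMap F _ (w : F) ∈ P) ∧
      ∀ (σ : L ≃ₐ[K] L) (ζ : ι → Fˣ), (∀ j, σ (y j) = algebraMap F L (ζ j) * y j) →
        σ z = algebraMap F L ((∏ j, ζ j ^ (e j).val : Fˣ) : F) * z := by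
  have hϖ : algebraMap A L ϖ ≠ 0 := by
    rw [Ne, FaithfulSMul.algebraMap_eq_zero_iff]; exact h.prime.ne_zero
  rw [AddMonoidHom.mem_ker, orderHom_apply, ZMod.intCast_zmod_eq_zero_iff_dvd] at he
  obtain ⟨m, hm⟩ := he
  have hz := h.unit_pow hϖ hr (fun j => (e j).val) hm
  set z := (∏ j, y j ^ (e j).val) * algebraMap A L ϖ ^ (-m) with hzdef
  have hint : IsIntegral A z := by
    refine IsIntegral.of_pow (NeZero.pos N) ?_
    rw [hz]; exact isIntegral_algebraMap
  refine ⟨⟨z, hint⟩, fun P hPp hP => ?_, fun σ ζ hσ => ?_⟩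
  · obtain ⟨w, hw⟩ := hw
    have hzB : (⟨z, hint⟩ : integralClosure A L) ^ N =
        algebraMap A _ (∏ j, g j ^ (N / r j * (e j).val)) := Subtype.ext (by simpa using hz)
    -- In the domain `B ⧸ P` the residue of `z` and the constant `w` have equal `N`-th powers, so
    -- they differ by a root of unity, which lies in `F`.
    have h2 : (Ideal.Quotient.mk P ⟨z, hint⟩) ^ N =
        algebraMap F (integralClosure A L ⧸ P) (w : F) ^ N := by
      rw [← map_pow, hzB, ← map_pow, ← Units.val_pow_eq_pow_val, hw,
        IsScalarTower.algebraMap_apply F (integralClosure A L) (_ ⧸ P),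
        Ideal.Quotient.algebraMap_eq, Ideal.Quotient.eq,
        IsScalarTower.algebraMap_apply F A (integralClosure A L), ← map_sub]
      obtain ⟨a, ha⟩ := h.dvd_prod_sub fun j => N / r j * (e j).val
      rw [ha, map_mul]
      exact P.mul_mem_right _ hP
    obtain ⟨w', hw'⟩ := exists_eq_algebraMap_of_pow_eq h2
    refine ⟨w', ?_⟩
    rw [← Ideal.Quotient.eq, hw', IsScalarTower.algebraMap_apply F (integralClosure A L) (_ ⧸ P),
        Ideal.Quotient.algebraMap_eq]
  · have h3 : σ (algebraMap A L ϖ) = algebraMap A L ϖ := by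
      rw [IsScalarTower.algebraMap_apply A K L, AlgEquiv.commutes]
    change σ z = _ * z
    simp only [hzdef, map_mul, map_prod, map_pow, hσ, mul_pow, Finset.prod_mul_distrib, map_zpow₀,
      h3, Units.coe_prod, Units.val_pow_eq_pow_val]
    ring

variable [IsDedekindDomain A] [IsFractionRing A K] [FiniteDimensional K L]

/-- Above a place satisfying the norm condition there are at least as many primes as there are
unramified exponent vectors. -/
theorem IsLocalKummer.card_ker_le_ncard_primesOver [NeZero N]
    [HasEnoughRootsOfUnity F N] (h : IsLocalKummer ϖ r k g b y) (hr : ∀ j, r j ∣ N)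
    [∀ j, NeZero (r j)] (hcard : Nat.card (L ≃ₐ[K] L) = ∏ j, r j)
    (hgen : IntermediateField.adjoin K (Set.range y) = ⊤)
    (hfin : ((Ideal.span {ϖ}).primesOver (integralClosure A L)).Finite)
    (hnorm : ∀ e ∈ (orderHom hr k).ker, ∃ w : Fˣ, w ^ N = ∏ j, b j ^ (N / r j * (e j).val)) :
    Nat.card (orderHom hr k).ker ≤ ((Ideal.span {ϖ}).primesOver (integralClosure A L)).ncard := by
  have hAL : Function.Injective (algebraMap A L) := by
    rw [IsScalarTower.algebraMap_eq A K L]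
    exact (algebraMap K L).injective.comp (IsFractionRing.injective A K)
  have : FaithfulSMul A L := (faithfulSMul_iff_algebraMap_injective A L).2 hAL
  have : (Ideal.span {ϖ}).IsPrime := (Ideal.span_singleton_prime h.prime.ne_zero).2 h.prime
  have : (Ideal.span {ϖ}).IsMaximal := ‹(Ideal.span {ϖ}).IsPrime›.isMaximal (by
    simpa using h.prime.ne_zero)
  obtain ⟨⟨P, hPp, hPl⟩⟩ : Nonempty ((Ideal.span {ϖ}).primesOver (integralClosure A L)) :=
    inferInstance
  have hϖP : ∀ Q : Ideal (integralClosure A L), Q.LiesOver (Ideal.span {ϖ}) →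
      algebraMap A (integralClosure A L) ϖ ∈ Q := fun Q hQ => by
    rw [← Ideal.mem_comap]
    change ϖ ∈ Q.under A
    rw [← hQ.over]
    exact Ideal.mem_span_singleton_self _
  choose! z hz1 hz2 using fun (e : (j : ι) → ZMod (r j)) (he : e ∈ (orderHom hr k).ker) =>
    h.exists_integral_unit (K := K) hr he (hnorm e he)
  choose! w hw using fun (e : (j : ι) → ZMod (r j)) (he : e ∈ (orderHom hr k).ker) =>
    hz1 e he P hPp (hϖP P hPl)
  -- extension of characters
  have : Finite (Multiplicative ((j : ι) → ZMod (r j))) :=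
    inferInstanceAs (Finite ((j : ι) → ZMod (r j)))
  have hexp : Monoid.exponent (Multiplicative ((j : ι) → ZMod (r j))) ∣ N := by
    rw [Monoid.exponent_dvd_iff_forall_pow_eq_one]
    intro e
    apply Multiplicative.toAdd.injective
    rw [toAdd_pow, toAdd_one]
    funext j
    rw [Pi.smul_apply, nsmul_eq_mul, (ZMod.natCast_eq_zero_iff _ _).2 (hr j), zero_mul]
    rfl
  have : HasEnoughRootsOfUnity F (Monoid.exponent (Multiplicative ((j : ι) → ZMod (r j)))) := HasEnoughRootsOfUnity.of_dvd F hexp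
  let U : Subgroup (Multiplicative ((j : ι) → ZMod (r j))) := AddSubgroup.toSubgroup (orderHom hr k).ker
  have hsurj := MonoidHom.domRestrict_surjective F U
  have hUexp : HasEnoughRootsOfUnity F (Monoid.exponent U) :=
    HasEnoughRootsOfUnity.of_dvd F (Monoid.exponent_submonoid_dvd U.toSubmonoid)
  choose Φ hΦ using hsurj
  -- The values of an extension of `φ` at the basis vectors are the roots of unity by which `σ`
  -- multiplies the `y j`.
  have hσ : ∀ φ : U →* Fˣ, ∃ σ : L ≃ₐ[K] L, ∀ e (he : e ∈ (orderHom hr k).ker),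
      σ (z e) = algebraMap F L (φ ⟨Multiplicative.ofAdd e, he⟩ : Fˣ) * z e := by
    intro φ
    let ζ : ι → Fˣ := fun j => by
      classical exact Φ φ (Multiplicative.ofAdd (Pi.single j 1))
    have hζ : ∀ j, ζ j ^ r j = 1 := by
      intro j
      classical
      have h1 : ζ j = Φ φ (Multiplicative.ofAdd (Pi.single j 1)) := rfl
      rw [h1, ← map_pow, ← ofAdd_nsmul, ← Pi.single_smul, nsmul_eq_mul, CharP.cast_eq_zero,
        zero_mul, Pi.single_zero, ofAdd_zero, map_one]
    obtain ⟨σ, hσ⟩ := exists_algEquiv_of_rootsOfUnity hr hcard y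
      (fun j => algebraMap A K ϖ ^ k j * algebraMap A K (g j)) h.root_ne_zero
      (fun j => by rw [h.root, map_mul, map_zpow₀, ← IsScalarTower.algebraMap_apply,
        ← IsScalarTower.algebraMap_apply]) hgen ζ hζ
    refine ⟨σ, fun e he => ?_⟩
    rw [hz2 e he σ ζ hσ]
    congr 3
    have h1 : φ ⟨Multiplicative.ofAdd e, he⟩ = Φ φ (Multiplicative.ofAdd e) := by
      conv_lhs => rw [← hΦ φ]
      rfl
    have h2 : e = ∑ j, (e j).val • (by classical exact Pi.single j (1 : ZMod (r j))) := by
      classical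
      conv_lhs => rw [← Finset.univ_sum_single e]
      refine Finset.sum_congr rfl fun j _ => ?_
      rw [← Pi.single_smul]
      simp
    rw [h1]
    conv_rhs => rw [h2]
    rw [ofAdd_sum, map_prod]
    refine Finset.prod_congr rfl fun j _ => ?_
    rw [ofAdd_nsmul, map_pow]
  choose σ hσ using hσ
  let s : (U →* Fˣ) → integralClosure A L ≃ₐ[A] integralClosure A L := fun φ =>
    ((σ φ).restrictScalars A).mapIntegralClosure
  have hs : ∀ φ e (he : e ∈ (orderHom hr k).ker),
      s φ (z e) = algebraMap F _ (φ ⟨Multiplicative.ofAdd e, he⟩ : Fˣ).val * z e := by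
    intro φ e he
    apply Subtype.ext
    exact hσ φ e he
  -- At the translate `Q φ` the unit `z e` has residue `φ e * w e`, so the prime remembers `φ`.
  let Q : (U →* Fˣ) → (Ideal.span {ϖ}).primesOver (integralClosure A L) := fun φ =>
    ⟨P.comap (s φ), inferInstance, inferInstance⟩
  have hsF : ∀ φ (c : F), s φ (algebraMap F _ c) = algebraMap F _ c := fun φ c => by
    rw [IsScalarTower.algebraMap_apply F A (integralClosure A L), AlgEquiv.commutes]
  have hQ : ∀ φ e (he : e ∈ (orderHom hr k).ker),
      z e - algebraMap F _ ((φ ⟨Multiplicative.ofAdd e, he⟩ : Fˣ).val * (w e).val) ∈ (Q φ).1 := by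
    intro φ e he
    change s φ _ ∈ P
    rw [map_sub, hs φ e he, hsF, map_mul, ← mul_sub]
    exact P.mul_mem_left _ (hw e he)
  have hinj : Function.Injective Q := by
    intro φ φ' hφ
    ext ⟨e, he⟩
    have h1 := hQ φ (Multiplicative.toAdd e) he
    have h2 := hQ φ' (Multiplicative.toAdd e) he
    rw [← hφ] at h2
    have h3 := (Q φ).1.sub_mem h2 h1
    rw [sub_sub_sub_cancel_left, ← map_sub] at h3
    have h4 : (φ ⟨e, he⟩ : Fˣ).val * (w (Multiplicative.toAdd e)).val -
        (φ' ⟨e, he⟩ : Fˣ).val * (w (Multiplicative.toAdd e)).val = 0 := by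
      by_contra h0
      exact (Q φ).2.1.ne_top (Ideal.eq_top_of_isUnit_mem _ h3
        ((isUnit_iff_ne_zero.2 h0).map (algebraMap F _)))
    exact mul_right_cancel₀ (w (Multiplicative.toAdd e)).ne_zero (sub_eq_zero.1 h4)
  have := hfin.to_subtype
  calc Nat.card (orderHom hr k).ker = Nat.card U := rfl
    _ = Nat.card (U →* Fˣ) := (CommGroup.card_monoidHom_of_hasEnoughRootsOfUnity U F).symm
    _ ≤ Nat.card ((Ideal.span {ϖ}).primesOver (integralClosure A L)) :=
        Nat.card_le_card_of_injective Q hinj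
    _ = _ := Nat.card_coe_set_eq _

/-- At a place satisfying the norm condition, the primes above it all have degree one, and there
are as many of them as there are unramified exponent vectors. -/
theorem IsLocalKummer.primesOver_of_norm_condition [NeZero N] [Algebra.IsSeparable K L]
    [HasEnoughRootsOfUnity F N] (h : IsLocalKummer ϖ r k g b y) (hr : ∀ j, r j ∣ N)
    [∀ j, NeZero (r j)] (hcard : Nat.card (L ≃ₐ[K] L) = ∏ j, r j)
    (hfinrank : Module.finrank K L = ∏ j, r j)
    (hgen : IntermediateField.adjoin K (Set.range y) = ⊤)
    (hnorm : ∀ e ∈ (orderHom hr k).ker, ∃ w : Fˣ, w ^ N = ∏ j, b j ^ (N / r j * (e j).val)) :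
    ((Ideal.span {ϖ}).primesOver (integralClosure A L)).ncard = Nat.card (orderHom hr k).ker ∧
    ∀ P ∈ (Ideal.span {ϖ}).primesOver (integralClosure A L), ∀ x : integralClosure A L,
      ∃ c : F, x - algebraMap F _ c ∈ P := by
  have hAL : Function.Injective (algebraMap A L) := by
    rw [IsScalarTower.algebraMap_eq A K L]
    exact (algebraMap K L).injective.comp (IsFractionRing.injective A K)
  have : FaithfulSMul A L := (faithfulSMul_iff_algebraMap_injective A L).2 hAL
  have hϖ : algebraMap A L ϖ ≠ 0 := by
    rw [Ne, FaithfulSMul.algebraMap_eq_zero_iff]; exact h.prime.ne_zero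
  have hp0 : Ideal.span {ϖ} ≠ ⊥ := by simpa using h.prime.ne_zero
  have : (Ideal.span {ϖ}).IsPrime := (Ideal.span_singleton_prime h.prime.ne_zero).2 h.prime
  have : (Ideal.span {ϖ}).IsMaximal := ‹(Ideal.span {ϖ}).IsPrime›.isMaximal hp0
  have hded : IsDedekindDomain (integralClosure A L) := integralClosure.isDedekindDomain A K L
  have hfrac : IsFractionRing (integralClosure A L) L :=
    integralClosure.isFractionRing_of_finite_extension K L
  have hmod : Module.Finite A (integralClosure A L) := IsIntegralClosure.finite A K L _
  have hfin : ((Ideal.span {ϖ}).primesOver (integralClosure A L)).Finite :=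
    IsDedekindDomain.primesOver_finite _ _
  have hrank : Module.finrank A (integralClosure A L) =
      Nat.card (orderHom hr k).ker * Nat.card (orderHom hr k).range := by
    rw [← IsFractionRing.finrank_eq A K (integralClosure A L) L, hfinrank,
      ← AddSubgroup.index_ker, AddSubgroup.card_mul_index, Nat.card_pi]
    simp
  have := hfin.to_subtype
  obtain ⟨h1, h2⟩ := primesOver_of_ramification_bound (Ideal.span {ϖ})
    (B := integralClosure A L) Nat.card_pos hrank (fun P hP => by
      have := hP.1
      have := hP.2
      have hϖP : algebraMap A (integralClosure A L) ϖ ∈ P := by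
        rw [← Ideal.mem_comap]
        change ϖ ∈ P.under A
        rw [← hP.2.over]
        exact Ideal.mem_span_singleton_self _
      have hϖB : algebraMap A (integralClosure A L) ϖ ≠ 0 := fun h0 => hϖ (by
        rw [IsScalarTower.algebraMap_apply A (integralClosure A L) L, h0, map_zero])
      rw [Ideal.IsDedekindDomain.ramificationIdx_eq_multiplicity (Ideal.span {ϖ}) P
        (by simpa [Ideal.map_span] using hϖB), Ideal.map_span, Set.image_singleton]
      -- The ramification index kills the range of `orderHom` inside the cyclic group `ℤ/N`.
      refine card_addSubgroup_le_of_nsmul_eq_zero ?_ _ ?_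
      · exact multiplicity_pos_of_dvd (Ideal.dvd_span_singleton.2 hϖP)
      · rintro _ ⟨e, rfl⟩
        exact h.nsmul_orderHom_eq_zero hr P hϖ hϖP e)
    (h.card_ker_le_ncard_primesOver hr hcard hgen hfin hnorm)
  refine ⟨h1, fun P hP x => ?_⟩
  have := hP.1
  have := hP.2
  have hPmax : P.IsMaximal := Ideal.IsMaximal.of_liesOver_isMaximal P (Ideal.span {ϖ})
  obtain ⟨a, ha⟩ := exists_sub_mem_of_inertiaDeg_eq_one (Ideal.span {ϖ}) P (h2 P hP) x
  obtain ⟨c, hc⟩ := h.residue a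
  refine ⟨c, ?_⟩
  obtain ⟨a', ha'⟩ := hc
  have hϖP : algebraMap A (integralClosure A L) ϖ ∈ P := by
    rw [← Ideal.mem_comap]
    change ϖ ∈ P.under A
    rw [← hP.2.over]
    exact Ideal.mem_span_singleton_self _
  rw [← sub_add_sub_cancel _ (algebraMap A _ a), IsScalarTower.algebraMap_apply F A
    (integralClosure A L), ← map_sub, ha', map_mul]
  exact P.add_mem ha (P.mul_mem_right _ hϖP)

end PrimesOver

/-! ### Rational points as valuation subrings. -/

section Rational

variable {F L : Type*} [Field F] [Field L] [Algebra F L]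

/-- Injectivity of `F → V / 𝔪` is automatic, so rationality only asks that each element of `V` be
congruent to a constant. -/
theorem mem_rationalPoints_iff {V : ValuationSubring L} :
    V ∈ rationalPoints F L ↔ (∀ a : F, algebraMap F L a ∈ V) ∧ IsDiscreteValuationRing V ∧
      ∀ x ∈ V, ∃ c : F, V.valuation (x - algebraMap F L c) < 1 := by
  have key : ∀ h : IsCurvePoint F V, ∀ (x : V) (c : F),
      h.toResidueField c = IsLocalRing.residue V x ↔
        V.valuation ((x : L) - algebraMap F L c) < 1 := by
    intro h x c
    have h1 : h.toResidueField c = IsLocalRing.residue V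
        ((algebraMap F L).codRestrict V.toSubring h.const_mem c) := rfl
    rw [h1, eq_comm, ← sub_eq_zero, ← map_sub, IsLocalRing.residue_eq_zero_iff,
      ValuationSubring.valuation_lt_one_iff]
    rfl
  constructor
  · rintro ⟨h, hb⟩
    refine ⟨h.const_mem, h.dvr, fun x hx => ?_⟩
    obtain ⟨c, hc⟩ := hb.2 (IsLocalRing.residue V ⟨x, hx⟩)
    exact ⟨c, (key h ⟨x, hx⟩ c).1 hc⟩
  · rintro ⟨h1, h2, h3⟩
    refine ⟨⟨h1, h2⟩, RingHom.injective _, fun z => ?_⟩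
    obtain ⟨x, rfl⟩ := IsLocalRing.residue_surjective z
    obtain ⟨c, hc⟩ := h3 x x.2
    exact ⟨c, (key ⟨h1, h2⟩ x c).2 hc⟩

theorem eq_zero_of_valuation_algebraMap_lt_one {V : ValuationSubring L}
    (hV : ∀ a : F, algebraMap F L a ∈ V) {a : F} (h : V.valuation (algebraMap F L a) < 1) :
    a = 0 := by
  by_contra ha
  have h1 : V.valuation (algebraMap F L a⁻¹) ≤ 1 := (V.valuation_le_one_iff _).2 (hV _)
  have h2 : V.valuation (algebraMap F L a) * V.valuation (algebraMap F L a⁻¹) = 1 := by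
    rw [← map_mul, ← map_mul, mul_inv_cancel₀ ha, map_one, map_one]
  exact (mul_lt_one_of_lt_of_le h h1).ne h2

/-- The rational points at which `t` vanishes. -/
def rationalZeros (F : Type*) {L : Type*} [Field F] [Field L] [Algebra F L] (t : L) :
    Set (ValuationSubring L) :=
  {V | V ∈ rationalPoints F L ∧ V.valuation t < 1}

theorem valuation_lt_one_valuationSubring_iff {Γ : Type*} [LinearOrderedCommGroupWithZero Γ]
    (v : Valuation L Γ) (x : L) : v.valuationSubring.valuation x < 1 ↔ v x < 1 :=
  (v.isEquiv_valuation_valuationSubring.lt_one_iff_lt_one).symm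

variable {A : Type*} [CommRing A] [Algebra F A] [Algebra A L] [IsScalarTower F A L] {ϖ : A}

theorem algebraMap_mem_of_adjoin (hadj : Algebra.adjoin F {ϖ} = ⊤) {V : ValuationSubring L}
    (hV : ∀ a : F, algebraMap F L a ∈ V) (hϖ : algebraMap A L ϖ ∈ V) (a : A) :
    algebraMap A L a ∈ V := by
  have ha : a ∈ Algebra.adjoin F {ϖ} := hadj ▸ Algebra.mem_top
  induction ha using Algebra.adjoin_induction with
  | mem x hx => rw [Set.mem_singleton_iff.1 hx]; exact hϖ
  | algebraMap c => rw [← IsScalarTower.algebraMap_apply]; exact hV c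
  | add x z _ _ hx hz => rw [map_add]; exact V.add_mem _ _ hx hz
  | mul x z _ _ hx hz => rw [map_mul]; exact V.mul_mem _ _ hx hz

theorem valuation_lt_one_of_dvd (hadj : Algebra.adjoin F {ϖ} = ⊤) {V : ValuationSubring L}
    (hV : ∀ a : F, algebraMap F L a ∈ V) (hϖ : V.valuation (algebraMap A L ϖ) < 1) {a : A}
    (h : ϖ ∣ a) : V.valuation (algebraMap A L a) < 1 := by
  obtain ⟨c, rfl⟩ := h
  rw [map_mul, map_mul]
  exact mul_lt_one_of_lt_of_le hϖ ((V.valuation_le_one_iff _).2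
    (algebraMap_mem_of_adjoin hadj hV ((V.valuation_le_one_iff _).1 hϖ.le) c))

variable {ι : Type*} [Fintype ι] {r : ι → ℕ} {k : ι → ℤ} {g : ι → A} {b : ι → Fˣ} {y : ι → L}
  {N : ℕ}

/-- At a place below a rational point the norm condition holds. -/
theorem IsLocalKummer.norm_condition [FaithfulSMul A L] [NeZero N]
    (h : IsLocalKummer ϖ r k g b y) (hr : ∀ j, r j ∣ N) [∀ j, NeZero (r j)]
    (hadj : Algebra.adjoin F {ϖ} = ⊤)
    {V : ValuationSubring L} (hV : V ∈ rationalZeros F (algebraMap A L ϖ))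
    (e : (j : ι) → ZMod (r j)) (he : e ∈ (orderHom hr k).ker) :
    ∃ w : Fˣ, w ^ N = ∏ j, b j ^ (N / r j * (e j).val) := by
  obtain ⟨hV, hVϖ⟩ := hV
  obtain ⟨hF, -, hres⟩ := mem_rationalPoints_iff.1 hV
  have hϖ : algebraMap A L ϖ ≠ 0 := by
    rw [Ne, FaithfulSMul.algebraMap_eq_zero_iff]; exact h.prime.ne_zero
  rw [AddMonoidHom.mem_ker, orderHom_apply, ZMod.intCast_zmod_eq_zero_iff_dvd] at he
  obtain ⟨m, hm⟩ := he
  have hz := h.unit_pow hϖ hr (fun j => (e j).val) hm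
  set z := (∏ j, y j ^ (e j).val) * algebraMap A L ϖ ^ (-m) with hzdef
  have hA := algebraMap_mem_of_adjoin hadj hF ((V.valuation_le_one_iff _).1 hVϖ.le)
  have hzV : z ∈ V := by
    rw [← V.valuation_le_one_iff, ← pow_le_one_iff (NeZero.ne N), ← map_pow, hz,
      V.valuation_le_one_iff]
    exact hA _
  obtain ⟨w, hw⟩ := hres z hzV
  -- Both `w ^ N` and the product of the `b j` are constants congruent to `z ^ N` modulo the maximal
  -- ideal, hence they are equal.
  have h1 : V.valuation (z ^ N - algebraMap F L w ^ N) < 1 := by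
    obtain ⟨q, hq⟩ : ∃ q ∈ V, z ^ N - algebraMap F L w ^ N = (z - algebraMap F L w) * q := by
      obtain ⟨q, hq⟩ := sub_dvd_pow_sub_pow (⟨z, hzV⟩ : V) ⟨algebraMap F L w, hF w⟩ N
      exact ⟨q, q.2, congrArg Subtype.val hq⟩
    rw [hq.2, map_mul]
    exact mul_lt_one_of_lt_of_le hw ((V.valuation_le_one_iff _).2 hq.1)
  have h2 := valuation_lt_one_of_dvd hadj hF hVϖ (h.dvd_prod_sub fun j => N / r j * (e j).val)
  rw [map_sub, ← hz, ← IsScalarTower.algebraMap_apply] at h2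
  have h3 := eq_zero_of_valuation_algebraMap_lt_one (F := F) (V := V) hF
    (a := w ^ N - (∏ j, b j ^ (N / r j * (e j).val) : Fˣ)) (by
      rw [map_sub, map_pow, ← sub_sub_sub_cancel_left]
      exact lt_of_le_of_lt (V.valuation.map_sub _ _) (max_lt h2 h1))
  rw [sub_eq_zero] at h3
  have hw0 : w ≠ 0 := fun h0 => by
    rw [h0, zero_pow (NeZero.ne N)] at h3
    exact Units.ne_zero _ h3.symm
  exact ⟨Units.mk0 w hw0, Units.ext (by simpa using h3)⟩

end Rational

/-! ### Rational points above a place and primes of the integral closure. -/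

section Bijection

open IsDedekindDomain

variable {F A L : Type*} [Field F] [CommRing A] [Field L] [Algebra F A] [Algebra A L]
  [Algebra F L] [IsScalarTower F A L] {ϖ : A}

theorem isDiscreteValuationRing_valuationSubringAtPrime {B L : Type*} [CommRing B]
    [IsDedekindDomain B] [Field L] [Algebra B L] [IsFractionRing B L] (v : HeightOneSpectrum B) :
    IsDiscreteValuationRing (HeightOneSpectrum.valuationSubringAtPrime L v) :=
  have := v.isPrime
  IsLocalization.AtPrime.isDiscreteValuationRing_of_dedekind_domain _ v.ne_bot
    (HeightOneSpectrum.valuationSubringAtPrime L v)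

/-- The rational points at which `ϖ` vanishes correspond to the primes above `ϖ`, if those have
residue field `F`. -/
theorem ncard_rationalZeros_eq_ncard_primesOver (K : Type*) [IsDedekindDomain A] [Field K]
    [Algebra A K] [IsFractionRing A K] [Algebra K L] [IsScalarTower A K L] [FiniteDimensional K L]
    [Algebra.IsSeparable K L] (hϖ : Prime ϖ)
    (hadj : Algebra.adjoin F {ϖ} = ⊤)
    (hres : ∀ P ∈ (Ideal.span {ϖ}).primesOver (integralClosure A L), ∀ x : integralClosure A L,
      ∃ c : F, x - algebraMap F _ c ∈ P) :
    (rationalZeros F (algebraMap A L ϖ)).Finite ∧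
    (rationalZeros F (algebraMap A L ϖ)).ncard =
      ((Ideal.span {ϖ}).primesOver (integralClosure A L)).ncard := by
  have hAL : Function.Injective (algebraMap A L) := by
    rw [IsScalarTower.algebraMap_eq A K L]
    exact (algebraMap K L).injective.comp (IsFractionRing.injective A K)
  have : FaithfulSMul A L := (faithfulSMul_iff_algebraMap_injective A L).2 hAL
  have hϖL : algebraMap A L ϖ ≠ 0 := by
    rw [Ne, FaithfulSMul.algebraMap_eq_zero_iff]; exact hϖ.ne_zero
  have hp0 : Ideal.span {ϖ} ≠ ⊥ := by simpa using hϖ.ne_zero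
  have : (Ideal.span {ϖ}).IsPrime := (Ideal.span_singleton_prime hϖ.ne_zero).2 hϖ
  have hpmax : (Ideal.span {ϖ}).IsMaximal := ‹(Ideal.span {ϖ}).IsPrime›.isMaximal hp0
  have hded : IsDedekindDomain (integralClosure A L) := integralClosure.isDedekindDomain A K L
  have hfrac : IsFractionRing (integralClosure A L) L :=
    integralClosure.isFractionRing_of_finite_extension K L
  have hϖP : ∀ P ∈ (Ideal.span {ϖ}).primesOver (integralClosure A L),
      algebraMap A (integralClosure A L) ϖ ∈ P := fun P hP => by
    rw [← Ideal.mem_comap]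
    change ϖ ∈ P.under A
    rw [← hP.2.over]
    exact Ideal.mem_span_singleton_self _
  have hϖB : algebraMap A (integralClosure A L) ϖ ≠ 0 := fun h0 => hϖL (by
    rw [IsScalarTower.algebraMap_apply A (integralClosure A L) L, h0, map_zero])
  let v : ∀ P ∈ (Ideal.span {ϖ}).primesOver (integralClosure A L),
      HeightOneSpectrum (integralClosure A L) :=
    fun P hP => ⟨P, hP.1, fun h0 => hϖB (by simpa [h0] using hϖP P hP)⟩
  have hmap : ∀ P hP, ((v P hP).valuation L).valuationSubring ∈
      rationalZeros F (algebraMap A L ϖ) := by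
    intro P hP
    refine ⟨mem_rationalPoints_iff.2 ⟨fun a => ?_, ?_, fun x hx => ?_⟩, ?_⟩
    · rw [Valuation.mem_valuationSubring_iff,
        IsScalarTower.algebraMap_apply F (integralClosure A L) L]
      exact (v P hP).valuation_le_one _
    · rw [← HeightOneSpectrum.valuationSubringAtPrime_eq_valuationSubring]
      exact isDiscreteValuationRing_valuationSubringAtPrime (v P hP)
    · rw [Valuation.mem_valuationSubring_iff] at hx
      -- Approximate first by an integral element, then by a constant.
      obtain ⟨a, ha⟩ := (v P hP).exists_valuation_sub_lt_of_integer hx 1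
      obtain ⟨c, hc⟩ := hres P hP a
      refine ⟨c, ?_⟩
      rw [valuation_lt_one_valuationSubring_iff]
      rw [Units.val_one, Valuation.map_sub_swap] at ha
      have h1 : (v P hP).valuation L (algebraMap (integralClosure A L) L a - algebraMap F L c) < 1 :=
        ((v P hP).valuation_lt_one_iff_mem (K := L) _).2 hc
      rw [← sub_add_sub_cancel _ (algebraMap (integralClosure A L) L a)]
      exact lt_of_le_of_lt (Valuation.map_add _ _ _) (max_lt ha h1)
    · rw [valuation_lt_one_valuationSubring_iff,
        IsScalarTower.algebraMap_apply A (integralClosure A L) L]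
      exact ((v P hP).valuation_lt_one_iff_mem (K := L) _).2 (hϖP P hP)
  have hsurj : ∀ V ∈ rationalZeros F (algebraMap A L ϖ), ∃ P hP,
      ((v P hP).valuation L).valuationSubring = V := by
    rintro V ⟨hV, hVϖ⟩
    obtain ⟨hF, -, -⟩ := mem_rationalPoints_iff.1 hV
    have hA := algebraMap_mem_of_adjoin hadj hF ((V.valuation_le_one_iff _).1 hVϖ.le)
    -- `V` contains `A = F[ϖ]` and is integrally closed, so it has a centre `P` on the integral
    -- closure.
    have hB : ∀ x : integralClosure A L, algebraMap (integralClosure A L) L x ∈ V := by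
      intro x
      let : Algebra A V := ((algebraMap A L).codRestrict V.toSubring hA).toAlgebra
      have : IsScalarTower A V L := IsScalarTower.of_algebraMap_eq fun _ => rfl
      have h1 : IsIntegral V (x : L) := IsIntegral.tower_top x.2
      obtain ⟨w, hw⟩ := IsIntegrallyClosed.isIntegral_iff.1 h1
      rw [show algebraMap (integralClosure A L) L x = (x : L) from rfl, ← hw]
      exact w.2
    let f : integralClosure A L →+* V :=
      (algebraMap (integralClosure A L) L).codRestrict V.toSubring hB
    let P := (IsLocalRing.maximalIdeal V).comap f
    have hPmem : ∀ x, x ∈ P ↔ V.valuation (algebraMap (integralClosure A L) L x) < 1 := fun x =>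
      (V.valuation_lt_one_iff (f x))
    have hPp : P.IsPrime := inferInstance
    have hP : P ∈ (Ideal.span {ϖ}).primesOver (integralClosure A L) := by
      refine ⟨hPp, ⟨hpmax.eq_of_le (Ideal.IsPrime.ne_top inferInstance) ?_⟩⟩
      rw [Ideal.span_singleton_le_iff_mem]
      change algebraMap A (integralClosure A L) ϖ ∈ P
      rw [hPmem, ← IsScalarTower.algebraMap_apply]
      exact hVϖ
    refine ⟨P, hP, ?_⟩
    have hne : V ≠ ⊤ := by
      intro h0
      have h1 : (algebraMap A L ϖ)⁻¹ ∈ V := h0 ▸ ValuationSubring.mem_top _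
      rw [← V.valuation_le_one_iff] at h1
      have h2 : V.valuation (algebraMap A L ϖ) * V.valuation (algebraMap A L ϖ)⁻¹ = 1 := by
        rw [← map_mul, mul_inv_cancel₀ hϖL, map_one]
      exact (mul_lt_one_of_lt_of_le hVϖ h1).ne h2
    -- The local ring at `P` is a discrete valuation ring, so its only overrings in `L` are itself
    -- and `L`; hence containment in `V ≠ ⊤` is equality.
    rw [← HeightOneSpectrum.valuationSubringAtPrime_eq_valuationSubring]
    refine ValuationSubring.eq_of_le_of_ne_top _ ?_ hne
    rw [HeightOneSpectrum.valuationSubringAtPrime_eq_valuationSubring]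
    intro x hx
    rw [Valuation.mem_valuationSubring_iff] at hx
    obtain ⟨n, ⟨d, hd⟩, hnd⟩ := (v P hP).exists_primeCompl_mul_eq_of_integer x hx
    have hd1 : V.valuation (algebraMap (integralClosure A L) L d) = 1 :=
      le_antisymm ((V.valuation_le_one_iff _).2 (hB d)) (not_lt.1 fun h0 => hd ((hPmem d).2 h0))
    rw [← V.valuation_le_one_iff, ← mul_one (V.valuation x), ← hd1, ← map_mul]
    simp only at hnd
    rw [hnd, hd1, V.valuation_le_one_iff]
    exact hB n
  have hinj : ∀ P Q hP hQ, ((v P hP).valuation L).valuationSubring =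
      ((v Q hQ).valuation L).valuationSubring → P = Q := by
    intro P Q hP hQ h
    have := HeightOneSpectrum.eq_of_valuation_isEquiv_valuation
      ((Valuation.isEquiv_iff_valuationSubring _ _).2 h)
    exact congrArg HeightOneSpectrum.asIdeal this
  have hcard := Set.ncard_congr (s := (Ideal.span {ϖ}).primesOver (integralClosure A L))
    (t := rationalZeros F (algebraMap A L ϖ)) (fun P hP => ((v P hP).valuation L).valuationSubring)
    hmap hinj (fun V hV => by obtain ⟨P, hP, h⟩ := hsurj V hV; exact ⟨P, hP, h⟩)
  refine ⟨?_, hcard.symm⟩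
  have hfin : ((Ideal.span {ϖ}).primesOver (integralClosure A L)).Finite :=
    IsDedekindDomain.primesOver_finite _ _
  have := hfin.to_subtype
  refine (Set.finite_range fun P : (Ideal.span {ϖ}).primesOver (integralClosure A L) =>
    ((v P.1 P.2).valuation L).valuationSubring).subset fun V hV => ?_
  obtain ⟨P, hP, h⟩ := hsurj V hV
  exact ⟨⟨P, hP⟩, h⟩

end Bijection

/-! ### The number of rational points in a fibre. -/

open Classical in
/-- The number of rational points above a place with residue field `F`. -/
theorem IsLocalKummer.ncard_rationalZeros {F A L ι : Type*} (K : Type*) [Field F] [CommRing A]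
    [IsDedekindDomain A] [Field K] [Field L] [Algebra F A] [Algebra A K] [IsFractionRing A K]
    [Algebra K L] [Algebra A L] [IsScalarTower A K L] [Algebra F L] [IsScalarTower F A L]
    [FiniteDimensional K L] [Algebra.IsSeparable K L] [Fintype ι] {ϖ : A} {r : ι → ℕ} {k : ι → ℤ}
    {g : ι → A} {b : ι → Fˣ} {y : ι → L} {N : ℕ} [NeZero N] [HasEnoughRootsOfUnity F N]
    (h : IsLocalKummer ϖ r k g b y) (hr : ∀ j, r j ∣ N) [∀ j, NeZero (r j)]
    (hadj : Algebra.adjoin F {ϖ} = ⊤) (hcard : Nat.card (L ≃ₐ[K] L) = ∏ j, r j)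
    (hfinrank : Module.finrank K L = ∏ j, r j)
    (hgen : IntermediateField.adjoin K (Set.range y) = ⊤) :
    (rationalZeros F (algebraMap A L ϖ)).Finite ∧
    (rationalZeros F (algebraMap A L ϖ)).ncard =
      if ∀ e ∈ (orderHom hr k).ker, ∃ w : Fˣ, w ^ N = ∏ j, b j ^ (N / r j * (e j).val) then
        Nat.card (orderHom hr k).ker else 0 := by
  have hAL : Function.Injective (algebraMap A L) := by
    rw [IsScalarTower.algebraMap_eq A K L]
    exact (algebraMap K L).injective.comp (IsFractionRing.injective A K)
  have : FaithfulSMul A L := (faithfulSMul_iff_algebraMap_injective A L).2 hAL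
  split_ifs with hn
  · obtain ⟨h1, h2⟩ := h.primesOver_of_norm_condition hr hcard hfinrank hgen hn
    obtain ⟨h3, h4⟩ := ncard_rationalZeros_eq_ncard_primesOver K h.prime hadj h2
    exact ⟨h3, h4.trans h1⟩
  · have : rationalZeros F (algebraMap A L ϖ) = ∅ := by
      rw [Set.eq_empty_iff_forall_notMem]
      exact fun V hV => hn fun e he => h.norm_condition hr hadj hV e he
    simp [this]

open Classical in
/-- `IsLocalKummer.ncard_rationalZeros` for the subring `F[t]` of `K`. -/
theorem ncard_rationalZeros_of_transcendental {F K L ι : Type*} [Field F] [Field K] [Field L]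
    [Algebra F K] [Algebra K L] [Algebra F L] [IsScalarTower F K L] [FiniteDimensional K L]
    [Algebra.IsSeparable K L] [Fintype ι] {r : ι → ℕ} {k : ι → ℤ} {g : ι → F[X]} {b : ι → Fˣ}
    {y : ι → L} {N : ℕ} [NeZero N] [HasEnoughRootsOfUnity F N] {t : K} (ht : Transcendental F t)
    (hfrac : ∀ z : K, ∃ p q : F[X], z = aeval t p / aeval t q)
    (hg : ∀ j, (g j).eval 0 = b j)
    (hy : ∀ j, y j ^ r j = algebraMap K L (t ^ k j * aeval t (g j)))
    (hr : ∀ j, r j ∣ N) [∀ j, NeZero (r j)] (hcard : Nat.card (L ≃ₐ[K] L) = ∏ j, r j)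
    (hfinrank : Module.finrank K L = ∏ j, r j)
    (hgen : IntermediateField.adjoin K (Set.range y) = ⊤) :
    (rationalZeros F (algebraMap K L t)).Finite ∧
    (rationalZeros F (algebraMap K L t)).ncard =
      if ∀ e ∈ (orderHom hr k).ker, ∃ w : Fˣ, w ^ N = ∏ j, b j ^ (N / r j * (e j).val) then
        Nat.card (orderHom hr k).ker else 0 := by
  -- Letting `X` act as `t` makes `K` the fraction field of `F[X]`, so finite places and infinity
  -- become the single place `X = 0`.
  let : Algebra F[X] K := (aeval t : F[X] →ₐ[F] K).toRingHom.toAlgebra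
  let : Algebra F[X] L := ((algebraMap K L).comp (aeval t : F[X] →ₐ[F] K).toRingHom).toAlgebra
  have hK : ∀ p : F[X], algebraMap F[X] K p = aeval t p := fun _ => rfl
  have : IsScalarTower F[X] K L := IsScalarTower.of_algebraMap_eq fun _ => rfl
  have : IsScalarTower F F[X] L := IsScalarTower.of_algebraMap_eq fun c => by
    rw [IsScalarTower.algebraMap_apply F[X] K L, hK, Polynomial.algebraMap_eq, aeval_C,
      ← IsScalarTower.algebraMap_apply]
  have : FaithfulSMul F[X] K :=
    (faithfulSMul_iff_algebraMap_injective _ _).2 (transcendental_iff_injective.1 ht)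
  have : IsFractionRing F[X] K := IsFractionRing.of_field _ _ hfrac
  have hdvd : ∀ (p : F[X]) (c : F), p.eval 0 = c → X ∣ p - algebraMap F F[X] c := fun p c h => by
    rw [X_dvd_iff, coeff_sub, coeff_zero_eq_eval_zero, h]
    simp
  have h : IsLocalKummer (X : F[X]) r k g b y :=
    { prime := prime_X
      residue := fun p => ⟨p.eval 0, hdvd p _ rfl⟩
      unit := fun j => hdvd _ _ (hg j)
      root := fun j => by
        rw [hy, IsScalarTower.algebraMap_apply F[X] K L, IsScalarTower.algebraMap_apply F[X] K L,
          hK, hK, aeval_X, map_mul, map_zpow₀] }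
  have := h.ncard_rationalZeros K hr Polynomial.adjoin_X hcard hfinrank hgen
  rwa [IsScalarTower.algebraMap_apply F[X] K L, hK, aeval_X] at this

/-! ### Points of the projective line and the partition into fibres. -/

section Line

variable {F : Type*} [Field F]

/-- The uniformizer of `F(X)` at a point of the projective line over `F`. -/
noncomputable def uniformizer : OnePoint F → RatFunc F
  | OnePoint.some x => algebraMap F[X] (RatFunc F) (X - C x)
  | OnePoint.infty => (RatFunc.X)⁻¹

theorem uniformizer_coe (x : F) :
    uniformizer (OnePoint.some x) = algebraMap F[X] (RatFunc F) (X - C x) := rfl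

theorem uniformizer_infty : uniformizer (OnePoint.infty : OnePoint F) = (RatFunc.X)⁻¹ := rfl

theorem transcendental_uniformizer (x : OnePoint F) : Transcendental F (uniformizer x) := by
  have hX : Transcendental F (RatFunc.X : RatFunc F) := RatFunc.transcendental_X
  induction x using OnePoint.rec with
  | infty => exact fun h => hX (IsAlgebraic.inv_iff.1 h)
  | coe x =>
    intro h
    refine hX ?_
    have h1 := h.add (isAlgebraic_algebraMap (R := F) (A := RatFunc F) x)
    have h2 : (RatFunc.X : RatFunc F) =
        uniformizer (OnePoint.some x) + algebraMap F (RatFunc F) x := by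
      simp [uniformizer, RatFunc.algebraMap_eq_C]
    rwa [h2]

theorem aeval_uniformizer_coe (x : F) (p : F[X]) :
    aeval (uniformizer (OnePoint.some x)) p = algebraMap F[X] (RatFunc F) (p.comp (X - C x)) := by
  rw [uniformizer_coe, aeval_algebraMap_apply, comp, aeval_def]
  rfl

theorem algebraMap_eq_uniformizer_infty (p : F[X]) :
    algebraMap F[X] (RatFunc F) p = uniformizer (OnePoint.infty : OnePoint F) ^
      (-(p.natDegree : ℤ)) * aeval (uniformizer (OnePoint.infty : OnePoint F)) p.reverse := by
  let : Invertible (RatFunc.X : RatFunc F) := invertibleOfNonzero RatFunc.X_ne_zero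
  have h := eval₂_reverse_mul_pow (algebraMap F (RatFunc F)) (RatFunc.X : RatFunc F) p
  rw [invOf_eq_inv, ← aeval_def, ← aeval_def] at h
  rw [uniformizer_infty, inv_zpow', neg_neg, zpow_natCast, mul_comm, h, ← RatFunc.algebraMap_X,
    aeval_algebraMap_apply, aeval_X_left_apply]

theorem exists_eq_aeval_uniformizer_div (x : OnePoint F) (z : RatFunc F) :
    ∃ p q : F[X], z = aeval (uniformizer x) p / aeval (uniformizer x) q := by
  rw [← RatFunc.num_div_denom z]
  induction x using OnePoint.rec with
  | infty =>
    set t := uniformizer (OnePoint.infty : OnePoint F) with ht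
    have ht0 : t ≠ 0 := inv_ne_zero RatFunc.X_ne_zero
    refine ⟨X ^ z.denom.natDegree * z.num.reverse, X ^ z.num.natDegree * z.denom.reverse, ?_⟩
    rw [algebraMap_eq_uniformizer_infty, algebraMap_eq_uniformizer_infty, ← ht]
    simp only [map_mul, map_pow, aeval_X, zpow_neg, zpow_natCast]
    -- This value is never zero, but no proof is needed: division by zero would make both sides `0`.
    by_cases h0 : aeval t z.denom.reverse = 0
    · simp [h0]
    field_simp
  | coe x =>
    refine ⟨z.num.comp (X + C x), z.denom.comp (X + C x), ?_⟩
    rw [aeval_uniformizer_coe, aeval_uniformizer_coe, comp_assoc, comp_assoc]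
    simp

variable {L : Type*} [Field L] [Algebra (RatFunc F) L] [Algebra F L]
  [IsScalarTower F (RatFunc F) L]

/-- Every rational point lies above a unique point of the projective line. -/
theorem rationalPoints_eq_iUnion :
    rationalPoints F L = ⋃ x : OnePoint F, rationalZeros F (algebraMap (RatFunc F) L
      (uniformizer x)) := by
  ext V
  simp only [Set.mem_iUnion]
  refine ⟨fun hV => ?_, fun ⟨x, hx⟩ => hx.1⟩
  obtain ⟨-, -, hres⟩ := mem_rationalPoints_iff.1 hV
  -- The point below `V` is the residue of `X`, or infinity when `X` has a pole.
  by_cases hX : algebraMap (RatFunc F) L RatFunc.X ∈ V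
  · obtain ⟨c, hc⟩ := hres _ hX
    refine ⟨OnePoint.some c, hV, ?_⟩
    simpa [uniformizer, IsScalarTower.algebraMap_apply F (RatFunc F) L,
      RatFunc.algebraMap_eq_C] using hc
  · refine ⟨OnePoint.infty, hV, ?_⟩
    rw [← V.valuation_le_one_iff, not_le] at hX
    simp only [uniformizer, map_inv₀]
    exact inv_lt_one_of_one_lt₀ hX

/-- At a common zero the nonzero constant `c' - c` would vanish, or `X` would be regular while its
inverse vanishes. -/
theorem disjoint_rationalZeros {x x' : OnePoint F} (hne : x ≠ x') :
    Disjoint (rationalZeros F (algebraMap (RatFunc F) L (uniformizer x)))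
      (rationalZeros F (algebraMap (RatFunc F) L (uniformizer x'))) := by
  have hinf : ∀ (V : ValuationSubring L) (c : F),
      V ∈ rationalZeros F (algebraMap (RatFunc F) L (uniformizer (OnePoint.some c))) →
      V ∉ rationalZeros F (algebraMap (RatFunc F) L (uniformizer OnePoint.infty)) := by
    rintro V c ⟨hV, h1⟩ ⟨-, h2⟩
    obtain ⟨hF, -, -⟩ := mem_rationalPoints_iff.1 hV
    have h3 : algebraMap (RatFunc F) L RatFunc.X =
        algebraMap (RatFunc F) L (uniformizer (OnePoint.some c)) + algebraMap F L c := by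
      simp [uniformizer, IsScalarTower.algebraMap_apply F (RatFunc F) L, RatFunc.algebraMap_eq_C]
    have h4 : algebraMap (RatFunc F) L RatFunc.X ∈ V := by
      rw [h3]
      exact V.add_mem _ _ ((V.valuation_le_one_iff _).1 h1.le) (hF c)
    have h5 : algebraMap (RatFunc F) L RatFunc.X ≠ 0 := by
      simpa using RatFunc.X_ne_zero
    rw [uniformizer_infty, map_inv₀] at h2
    have h6 : V.valuation (algebraMap (RatFunc F) L RatFunc.X)⁻¹ *
        V.valuation (algebraMap (RatFunc F) L RatFunc.X) = 1 := by
      rw [← map_mul, inv_mul_cancel₀ h5, map_one]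
    exact (mul_lt_one_of_lt_of_le h2 ((V.valuation_le_one_iff _).2 h4)).ne h6
  rw [Set.disjoint_left]
  intro V hV hV'
  induction x using OnePoint.rec with
  | infty =>
    induction x' using OnePoint.rec with
    | infty => exact hne rfl
    | coe c => exact hinf V c hV' hV
  | coe c =>
    induction x' using OnePoint.rec with
    | infty => exact hinf V c hV hV'
    | coe c' =>
      obtain ⟨hF, -, -⟩ := mem_rationalPoints_iff.1 hV.1
      have h1 : algebraMap F L (c' - c) =
          algebraMap (RatFunc F) L (uniformizer (OnePoint.some c)) -
            algebraMap (RatFunc F) L (uniformizer (OnePoint.some c')) := by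
        simp [uniformizer, IsScalarTower.algebraMap_apply F (RatFunc F) L,
          RatFunc.algebraMap_eq_C]
      have h2 := eq_zero_of_valuation_algebraMap_lt_one (V := V) hF (a := c' - c) (by
        rw [h1]
        exact lt_of_le_of_lt (V.valuation.map_sub _ _) (max_lt hV.2 hV'.2))
      exact hne (by rw [sub_eq_zero.1 h2])

theorem ncard_rationalPoints [Fintype F]
    (hfin : ∀ x : OnePoint F,
      (rationalZeros F (algebraMap (RatFunc F) L (uniformizer x))).Finite) :
    (rationalPoints F L).Finite ∧ (rationalPoints F L).ncard =
      ∑ x : OnePoint F, (rationalZeros F (algebraMap (RatFunc F) L (uniformizer x))).ncard := by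
  rw [rationalPoints_eq_iUnion]
  refine ⟨Set.finite_iUnion hfin, ?_⟩
  have := fun x => (hfin x).to_subtype
  rw [Set.ncard_iUnion_of_finite hfin fun x y hxy => disjoint_rationalZeros hxy,
    finsum_eq_sum_of_fintype]

end Line

/-! ### Multiplicative characters of a finite field. -/

section Characters

variable {F : Type*} [Field F]

theorem isPrimitiveRoot_mulChar_generator {g : Fˣ} (hg : ∀ x, x ∈ Subgroup.zpowers g)
    (ψ : MulChar F ℂ) {m : ℕ} (hψ : orderOf ψ = m) : IsPrimitiveRoot (ψ g) m := by
  rw [IsPrimitiveRoot.iff_orderOf, ← hψ, orderOf_eq_orderOf_iff]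
  intro i
  rw [MulChar.eq_iff hg, MulChar.pow_apply_coe]
  simp

variable [Fintype F]

/-- A character of order `m ∣ N` is a power, with exponent prime to `m`, of the `N / m`-th power of
a character of order `N`. -/
theorem exists_coprime_mulChar_eq_pow {N m : ℕ} [NeZero N] (hm : m ∣ N) {ψ χ : MulChar F ℂ}
    (hψ : orderOf ψ = N) (hχ : orderOf χ = m) :
    ∃ u : ℕ, u.Coprime m ∧ ∀ a : Fˣ, χ a = ψ a ^ (N / m * u) := by
  obtain ⟨g, hg⟩ := IsCyclic.exists_generator (α := Fˣ)
  have : NeZero m := ⟨fun h => NeZero.ne N (by simpa [h] using hm)⟩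
  have h1 := (isPrimitiveRoot_mulChar_generator hg ψ hψ).pow (NeZero.pos N)
    (Nat.div_mul_cancel hm).symm
  -- At a generator of `Fˣ`, both `ψ ^ (N / m)` and `χ` take primitive `m`-th roots of unity as
  -- values.
  obtain ⟨u, -, hu, h2⟩ := h1.isPrimitiveRoot_iff.1 (isPrimitiveRoot_mulChar_generator hg χ hχ)
  refine ⟨u, hu, fun a => ?_⟩
  rw [← MulChar.pow_apply_coe]
  congr 1
  rw [MulChar.eq_iff hg, MulChar.pow_apply_coe, ← h2, pow_mul]

/-- The kernel of a character of order `N` consists of the `N`-th powers. -/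
theorem mulChar_eq_one_iff {N : ℕ} {ψ : MulChar F ℂ} (hψ : orderOf ψ = N) (a : Fˣ) :
    ψ a = 1 ↔ ∃ w : Fˣ, w ^ N = a := by
  constructor
  · intro h
    obtain ⟨g, hg⟩ := IsCyclic.exists_monoid_generator (α := Fˣ)
    have hg' : ∀ x, x ∈ Subgroup.zpowers g := fun x => Submonoid.powers_le_zpowers g (hg x)
    obtain ⟨i, rfl⟩ := hg a
    have h1 := isPrimitiveRoot_mulChar_generator hg' ψ hψ
    obtain ⟨m, rfl⟩ := (h1.pow_eq_one_iff_dvd i).1 (by simpa using h)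
    exact ⟨g ^ m, by rw [← pow_mul, mul_comm]⟩
  · rintro ⟨w, rfl⟩
    rw [Units.val_pow_eq_pow_val, map_pow, ← MulChar.pow_apply_coe, ← hψ, pow_orderOf_eq_one,
      MulChar.one_apply_coe]

end Characters

/-! ### The pairs `(s, ω)` enumerate `∏ ℤ/r_j`. -/

section Reindex

variable {n : ℕ} {r : Fin n → ℕ}

theorem dvd_of_mem_divisorVectors {s : Fin n → ℕ} (hs : s ∈ divisorVectors r) (j : Fin n) :
    s j ∣ r j :=
  Nat.dvd_of_mem_divisors (Fintype.mem_piFinset.1 hs j)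

theorem dvd_ell (s : Fin n → ℕ) (j : Fin n) : s j ∣ ell s := Finset.dvd_lcm (Finset.mem_univ j)

theorem ell_dvd_ell {s : Fin n → ℕ} (hs : s ∈ divisorVectors r) : ell s ∣ ell r :=
  Finset.lcm_dvd fun j _ => (dvd_of_mem_divisorVectors hs j).trans (dvd_ell r j)

theorem card_omega (s : Fin n → ℕ) : (Omega s).card = ∏ j, (s j).totient := by
  rw [Omega, Fintype.card_piFinset]
  refine Finset.prod_congr rfl fun j _ => ?_
  rw [← Nat.filter_coprime_Ico_eq_totient (s j) 1]
  congr 1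
  ext w
  simp only [Finset.mem_filter, Finset.mem_Icc, Finset.mem_Ico, Nat.coprime_comm (n := w)]
  omega

theorem sum_card_omega (r : Fin n → ℕ) :
    ∑ s ∈ divisorVectors r, (Omega s).card = ∏ j, r j := by
  simp_rw [card_omega, divisorVectors]
  rw [← Finset.prod_univ_sum]
  exact Finset.prod_congr rfl fun j _ => Nat.sum_totient (r j)

/-- The exponent vector of the character attached to `(s, ω)`, twisted by multipliers `u`. -/
def exponentVector (r : Fin n → ℕ) (u : ℕ → ℕ) (s ω : Fin n → ℕ) : (j : Fin n) → ZMod (r j) :=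
  fun j => ((u (ell s) * ω j * (r j / s j) : ℕ) : ZMod (r j))

theorem gcd_mul_div {u w s r : ℕ} (hs : s ∣ r) (hu : u.Coprime s) (hw : w.Coprime s) :
    Nat.gcd (u * w * (r / s)) r = r / s := by
  obtain ⟨c, rfl⟩ := hs
  rcases Nat.eq_zero_or_pos s with rfl | h0
  · simp
  · rw [Nat.mul_div_cancel_left _ h0, Nat.gcd_mul_right,
      Nat.coprime_iff_gcd_eq_one.1 (hu.mul_left hw), one_mul]

/-- The `j`-th entry has additive order `s j`, which recovers `s`; then the multiplier `u (ell s)`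
is the same on both sides and invertible modulo `s j`, which recovers `ω`. -/
theorem exponentVector_injOn (hr : ∀ j, 0 < r j) (u : ℕ → ℕ)
    (hu : ∀ m, m ∣ ell r → (u m).Coprime m) {s ω s' ω' : Fin n → ℕ}
    (hs : s ∈ divisorVectors r) (hω : ω ∈ Omega s) (hs' : s' ∈ divisorVectors r)
    (hω' : ω' ∈ Omega s') (h : exponentVector r u s ω = exponentVector r u s' ω') :
    s = s' ∧ ω = ω' := by
  have hcop : ∀ {s ω : Fin n → ℕ}, s ∈ divisorVectors r → ω ∈ Omega s → ∀ j,
      (ω j).Coprime (s j) ∧ (u (ell s)).Coprime (s j) ∧ 1 ≤ ω j ∧ ω j ≤ s j := by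
    intro s ω hs hω j
    have h1 := Fintype.mem_piFinset.1 hω j
    rw [Finset.mem_filter, Finset.mem_Icc] at h1
    exact ⟨h1.2, (hu _ (ell_dvd_ell hs)).coprime_dvd_right (dvd_ell s j), h1.1⟩
  have hmod : ∀ j, u (ell s) * ω j * (r j / s j) ≡ u (ell s') * ω' j * (r j / s' j) [MOD r j] :=
    fun j => (ZMod.natCast_eq_natCast_iff _ _ _).1 (congrFun h j)
  have hss : s = s' := by
    funext j
    have h1 := (hmod j).gcd_eq
    have hd := dvd_of_mem_divisorVectors hs j
    have hd' := dvd_of_mem_divisorVectors hs' j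
    rw [gcd_mul_div hd (hcop hs hω j).2.1 (hcop hs hω j).1,
      gcd_mul_div hd' (hcop hs' hω' j).2.1 (hcop hs' hω' j).1] at h1
    rw [← Nat.div_div_self hd (hr j).ne', h1, Nat.div_div_self hd' (hr j).ne']
  subst hss
  refine ⟨rfl, funext fun j => ?_⟩
  have hd := dvd_of_mem_divisorVectors hs j
  obtain ⟨h1, h2, h3, h4⟩ := hcop hs hω j
  obtain ⟨h1', -, h3', h4'⟩ := hcop hs hω' j
  have h5 := hmod j
  have hpos : 0 < r j / s j := Nat.div_pos (Nat.le_of_dvd (hr j) hd) (by omega)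
  have h6 : u (ell s) * ω j ≡ u (ell s) * ω' j [MOD s j] := by
    refine Nat.ModEq.mul_right_cancel' hpos.ne' ?_
    rwa [Nat.mul_div_cancel' hd]
  have h7 : ω j ≡ ω' j [MOD s j] := Nat.ModEq.cancel_left_of_coprime h2.symm h6
  -- Representatives run over `1, …, s j`, so `s j` stands for the class `0` and is treated apart.
  rcases h4.eq_or_lt with h8 | h8 <;> rcases h4'.eq_or_lt with h9 | h9
  · omega
  · exfalso
    rw [h8] at h7
    have := (Nat.modEq_zero_iff_dvd.1 (h7.symm.trans (Nat.modEq_zero_iff_dvd.2 dvd_rfl)))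
    exact absurd (Nat.le_of_dvd (by omega) this) (by omega)
  · exfalso
    rw [h9] at h7
    have := (Nat.modEq_zero_iff_dvd.1 (h7.trans (Nat.modEq_zero_iff_dvd.2 dvd_rfl)))
    exact absurd (Nat.le_of_dvd (by omega) this) (by omega)
  · exact h7.eq_of_lt_of_lt h8 h9

/-- An injection between finite sets of equal size is a bijection; the sizes agree by `∑_{s ∣ r}
φ(s) = r` in each coordinate. -/
theorem sum_exponentVector {M : Type*} [AddCommMonoid M] (hr : ∀ j, 0 < r j) (u : ℕ → ℕ)
    (hu : ∀ m, m ∣ ell r → (u m).Coprime m) [∀ j, NeZero (r j)]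
    (f : ((j : Fin n) → ZMod (r j)) → M) :
    ∑ s ∈ divisorVectors r, ∑ ω ∈ Omega s, f (exponentVector r u s ω) = ∑ e, f e := by
  rw [Finset.sum_sigma']
  have hinj : Set.InjOn (fun p : (_ : Fin n → ℕ) × (Fin n → ℕ) => exponentVector r u p.1 p.2)
      ((divisorVectors r).sigma fun s => Omega s) := by
    rintro ⟨s, ω⟩ h1 ⟨s', ω'⟩ h2 h
    simp only [Finset.coe_sigma, Set.mem_sigma_iff, Finset.mem_coe] at h1 h2
    obtain ⟨rfl, rfl⟩ := exponentVector_injOn hr u hu h1.1 h1.2 h2.1 h2.2 h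
    rfl
  refine Finset.sum_nbij (fun p => exponentVector r u p.1 p.2) (fun _ _ => Finset.mem_univ _) hinj
    (Finset.surjOn_of_injOn_of_card_le _ (fun _ _ => Finset.mem_coe.2 (Finset.mem_univ _)) hinj ?_)
    fun _ _ => rfl
  rw [Finset.card_sigma, sum_card_omega r, Finset.card_univ, Fintype.card_pi]
  simp

end Reindex

/-! ### Orthogonality on the kernel of `orderHom`. -/

section Sum

variable {F : Type*} [Field F] [Fintype F] {n : ℕ} {r : Fin n → ℕ}

open Classical in
-- After reindexing, the left side sums a homomorphism to `ℂˣ` over the kernel of `orderHom`: the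
-- kernel's order if it is trivial, else `0`. Triviality means that all the products of the `b j`
-- are `N`-th powers.
theorem sum_mulChar_eq (hr : ∀ j, 0 < r j) (χ : ℕ → MulChar F ℂ)
    (hχ : ∀ m, m ∣ ell r → orderOf (χ m) = m) (b : Fin n → Fˣ) (k : Fin n → ℤ) :
    ∑ s ∈ divisorVectors r, ∑ ω ∈ Omega s,
      (if (ell s : ℤ) ∣ ∑ j, ((ell s / s j * ω j : ℕ) : ℤ) * k j then
        χ (ell s) ((∏ j, b j ^ (ell s / s j * ω j) : Fˣ) : F) else 0) =
    ((if ∀ e ∈ (orderHom (dvd_ell r) k).ker, ∃ w : Fˣ,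
        w ^ ell r = ∏ j, b j ^ (ell r / r j * (e j).val) then
      Nat.card (orderHom (dvd_ell r) k).ker else 0 : ℕ) : ℂ) := by
  have hN0 : ell r ≠ 0 := by
    rw [ell, Ne, Finset.lcm_eq_zero_iff]
    rintro ⟨j, -, h⟩
    exact (hr j).ne' h
  have : NeZero (ell r) := ⟨hN0⟩
  have : ∀ j, NeZero (r j) := fun j => ⟨(hr j).ne'⟩
  set N := ell r with hN
  set ψ := χ N with hψdef
  have hψ : orderOf ψ = N := hχ N dvd_rfl
  have hu : ∀ m, ∃ u : ℕ, m ∣ N → u.Coprime m ∧ ∀ a : Fˣ, χ m a = ψ a ^ (N / m * u) := by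
    intro m
    by_cases hm : m ∣ N
    · obtain ⟨u, hu⟩ := exists_coprime_mulChar_eq_pow hm hψ (hχ m hm)
      exact ⟨u, fun _ => hu⟩
    · exact ⟨0, fun h => absurd h hm⟩
  choose u hu using hu
  have hψN : ∀ a : Fˣ, ψ.toUnitHom a ^ N = 1 := fun a => by
    ext
    rw [Units.val_pow_eq_pow_val, MulChar.coe_toUnitHom, ← MulChar.pow_apply_coe, ← hψ,
      pow_orderOf_eq_one, MulChar.one_apply_coe, Units.val_one]
  let Θ : ((j : Fin n) → ZMod (r j)) →+ Additive ℂˣ :=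
    piHom (fun j => Additive.ofMul (ψ.toUnitHom (b j) ^ (N / r j))) fun j => by
      rw [← ofMul_pow, ← pow_mul, Nat.div_mul_cancel (dvd_ell r j), hψN, ofMul_one]
  have hΘcast : ∀ m : Fin n → ℕ, ((Θ fun j => (m j : ZMod (r j))).toMul : ℂ) =
      ψ ((∏ j, b j ^ (N / r j * m j) : Fˣ) : F) := by
    intro m
    rw [← MulChar.coe_toUnitHom, piHom_natCast, toMul_sum, map_prod]
    congr 1
    refine Finset.prod_congr rfl fun j _ => ?_
    rw [toMul_nsmul, toMul_ofMul, ← pow_mul, map_pow]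
  have hΘ : ∀ e : (j : Fin n) → ZMod (r j), ((Θ e).toMul : ℂ) =
      ψ ((∏ j, b j ^ (N / r j * (e j).val) : Fˣ) : F) := fun e => by
    rw [← hΘcast]
    congr 3
    funext j
    simp
  have hterm : ∀ s ∈ divisorVectors r, ∀ ω ∈ Omega s,
      (if (ell s : ℤ) ∣ ∑ j, ((ell s / s j * ω j : ℕ) : ℤ) * k j then
        χ (ell s) ((∏ j, b j ^ (ell s / s j * ω j) : Fˣ) : F) else 0) =
      if orderHom (dvd_ell r) k (exponentVector r u s ω) = 0 then
        ((Θ (exponentVector r u s ω)).toMul : ℂ) else 0 := by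
    intro s hs ω hω
    have hl : ell s ∣ N := ell_dvd_ell hs
    obtain ⟨M, hM⟩ := hl
    have hl0 : 0 < ell s := Nat.pos_of_ne_zero fun h0 => hN0 (by rw [hM, h0, zero_mul])
    have hM0 : 0 < M := Nat.pos_of_ne_zero fun h0 => hN0 (by rw [hM, h0, mul_zero])
    have hNM : N / ell s = M := by rw [hM, Nat.mul_div_cancel_left _ hl0]
    obtain ⟨hu1, hu2⟩ := hu (ell s) (ell_dvd_ell hs)
    -- Both sides equal `(N / s j) * ω j * u (ell s)`, with `M = N / ell s`.
    have hexp : ∀ j, N / r j * (u (ell s) * ω j * (r j / s j)) =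
        ell s / s j * ω j * (M * u (ell s)) := by
      intro j
      obtain ⟨c, hc⟩ := dvd_of_mem_divisorVectors hs j
      obtain ⟨c', hc'⟩ := dvd_ell s j
      obtain ⟨c'', hc''⟩ := dvd_ell r j
      have hr0 := hr j
      have hs0 : 0 < s j := Nat.pos_of_ne_zero fun h0 => hr0.ne' (by rw [hc, h0, zero_mul])
      have e1 : N / r j = c'' := by rw [hN, hc'', Nat.mul_div_cancel_left _ hr0]
      have e2 : r j / s j = c := by rw [hc, Nat.mul_div_cancel_left _ hs0]
      have e3 : ell s / s j = c' := by rw [hc', Nat.mul_div_cancel_left _ hs0]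
      have e4 : c'' * c = c' * M := by
        apply Nat.eq_of_mul_eq_mul_left hs0
        calc s j * (c'' * c) = s j * c * c'' := by ring
          _ = s j * c' * M := by rw [← hc, ← hc'', ← hc', ← hM]
          _ = _ := by ring
      rw [e1, e2, e3]
      calc c'' * (u (ell s) * ω j * c) = c'' * c * (u (ell s) * ω j) := by ring
        _ = _ := by rw [e4]; ring
    -- The factor `M` cancels from both sides, and `u (ell s)` drops out because it is prime to `ell
    -- s`.
    have hcond : (orderHom (dvd_ell r) k (exponentVector r u s ω) = 0) ↔
        (ell s : ℤ) ∣ ∑ j, ((ell s / s j * ω j : ℕ) : ℤ) * k j := by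
      unfold exponentVector
      rw [orderHom_natCast, ZMod.intCast_zmod_eq_zero_iff_dvd]
      have e1 : ∑ j, ((ell r / r j * (u (ell s) * ω j * (r j / s j)) : ℕ) : ℤ) * k j =
          (M : ℤ) * ((u (ell s) : ℤ) * ∑ j, ((ell s / s j * ω j : ℕ) : ℤ) * k j) := by
        rw [Finset.mul_sum, Finset.mul_sum]
        refine Finset.sum_congr rfl fun j _ => ?_
        rw [← hN, hexp, Nat.cast_mul _ (M * _), Nat.cast_mul M]
        ring
      rw [e1, show (ell r : ℤ) = (M : ℤ) * (ell s : ℤ) by rw [← hN, hM]; push_cast; ring,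
        mul_dvd_mul_iff_left (by exact_mod_cast hM0.ne')]
      exact ⟨(Nat.isCoprime_iff_coprime.2 hu1.symm).dvd_of_dvd_mul_left,
        fun h => Dvd.dvd.mul_left h _⟩
    simp only [hcond]
    refine if_congr Iff.rfl ?_ rfl
    unfold exponentVector
    rw [hΘcast, hu2, ← map_pow, ← Units.val_pow_eq_pow_val, ← Finset.prod_pow, hNM]
    congr 2
    refine Finset.prod_congr rfl fun j _ => ?_
    rw [← pow_mul, hexp]
  rw [Finset.sum_congr rfl fun s hs => Finset.sum_congr rfl fun ω hω => hterm s hs ω hω,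
    sum_exponentVector hr u (fun m hm => (hu m hm).1) (fun e =>
      if orderHom (dvd_ell r) k e = 0 then ((Θ e).toMul : ℂ) else 0), ← Finset.sum_filter]
  let f : Multiplicative (orderHom (dvd_ell r) k).ker →* ℂ :=
    (Units.coeHom ℂ).comp (AddMonoidHom.toMultiplicativeLeft
      (Θ.comp (orderHom (dvd_ell r) k).ker.subtype))
  have hf : ∀ e (he : e ∈ (orderHom (dvd_ell r) k).ker),
      f (Multiplicative.ofAdd ⟨e, he⟩) = ((Θ e).toMul : ℂ) := fun e he => rfl
  have : Fintype (orderHom (dvd_ell r) k).ker := Fintype.ofFinite _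
  have hsum := sum_hom_units f
  have hiff : f = 1 ↔ ∀ e ∈ (orderHom (dvd_ell r) k).ker, ∃ w : Fˣ,
      w ^ N = ∏ j, b j ^ (N / r j * (e j).val) := by
    rw [MonoidHom.ext_iff]
    constructor
    · intro h e he
      rw [← mulChar_eq_one_iff hψ, ← hΘ, ← hf e he]
      exact h _
    · intro h e
      have := h e.toAdd.1 e.toAdd.2
      rw [← mulChar_eq_one_iff hψ, ← hΘ] at this
      exact this
  simp only [hiff, ← Nat.card_eq_fintype_card] at hsum
  refine Eq.trans ?_ (hsum.trans ?_)
  · refine Finset.sum_bij' (fun e he => Multiplicative.ofAdd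
      (⟨e, (Finset.mem_filter.1 he).2⟩ : (orderHom (dvd_ell r) k).ker))
      (fun e _ => e.toAdd.1) (fun _ _ => Finset.mem_univ _)
      (fun e _ => Finset.mem_filter.2 ⟨Finset.mem_univ _, e.toAdd.2⟩) (fun _ _ => rfl)
      (fun _ _ => rfl) (fun _ _ => rfl)
  · refine congrArg Nat.cast ?_
    by_cases h : ∀ e ∈ (orderHom (dvd_ell r) k).ker, ∃ w : Fˣ,
        w ^ N = ∏ j, b j ^ (N / r j * (e j).val)
    · exact (if_pos h).trans (if_pos h).symm
    · exact (if_neg h).trans (if_neg h).symm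

end Sum

/-! ### Local expansions of the `F_j` and character values at each point. -/

section LocalData

variable {F : Type*} [Field F] {n : ℕ} {r : Fin n → ℕ}

theorem mulChar_pow_mod {χ : MulChar F ℂ} {m : ℕ} (hχ : χ ^ m = 1) (a : Fˣ) (i : ℕ) :
    χ a ^ (i % m) = χ a ^ i := by
  refine (pow_eq_pow_mod i ?_).symm
  rw [← MulChar.pow_apply_coe, hχ, MulChar.one_apply_coe]

theorem mulChar_leadCoeff {s : Fin n → ℕ} {χ : MulChar F ℂ} (hχ : χ ^ ell s = 1)
    (c : Fin n → Fˣ) (ω : Fin n → ℕ) :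
    χ (leadCoeff c s ω) = ∏ j, χ (c j) ^ (ell s / s j * ω j) := by
  simp only [leadCoeff, map_prod, map_pow]
  exact Finset.prod_congr rfl fun j _ => mulChar_pow_mod hχ _ _

/-- `k`, `g`, `b` describe the Kummer generators at the point `x`, and the values of characters at
`F_(s)^(ω)(x)` are determined by `k` and `b`. -/
structure IsLocalData (c : Fin n → Fˣ) (f : IndexSet r → F[X]) (x : OnePoint F) (k : Fin n → ℤ)
    (g : Fin n → F[X]) (b : Fin n → Fˣ) : Prop where
  eval_zero : ∀ j, (g j).eval 0 = b j
  kummerPoly_eq : ∀ j, algebraMap F[X] (RatFunc F) (kummerPoly c f j) =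
    uniformizer x ^ k j * aeval (uniformizer x) (g j)
  mulChar_twistedValue : ∀ (s ω : Fin n → ℕ) (χ : MulChar F ℂ), χ ^ ell s = 1 →
    χ (twistedValue c f s ω x) =
      if (ell s : ℤ) ∣ ∑ j, ((ell s / s j * ω j : ℕ) : ℤ) * k j then
        χ ((∏ j, b j ^ (ell s / s j * ω j) : Fˣ) : F) else 0

theorem twistedValue_infty (c : Fin n → Fˣ) (f : IndexSet r → F[X]) (s ω : Fin n → ℕ) :
    twistedValue c f s ω OnePoint.infty =
      if ell s ∣ ∑ j, ell s / s j * ω j * (kummerPoly c f j).natDegree then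
        leadCoeff c s ω else 0 := rfl

theorem twistedValue_coe (c : Fin n → Fˣ) (f : IndexSet r → F[X]) (s ω : Fin n → ℕ) (x : F) :
    twistedValue c f s ω (OnePoint.some x) = (twistedPoly c f s ω).eval x := rfl

/-- With uniformizer `1 / X` the order of `F_j` is `-deg F_j` and its unit part is the reversed
polynomial, whose constant term is the leading coefficient `c j`. -/
theorem isLocalData_infty (c : Fin n → Fˣ) {f : IndexSet r → F[X]} (hf : IsAdmissibleTuple f) :
    IsLocalData c f OnePoint.infty (fun j => -((kummerPoly c f j).natDegree : ℤ))
      (fun j => (kummerPoly c f j).reverse) c where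
  eval_zero j := by
    have h : (∏ α : IndexSet r, f α ^ (α.1 j : ℕ)).Monic :=
      monic_prod_of_monic _ _ fun α _ => (hf.1 α).1.pow _
    rw [← coeff_zero_eq_eval_zero, coeff_zero_reverse, kummerPoly, leadingCoeff_mul, leadingCoeff_C,
      h.leadingCoeff, mul_one]
  kummerPoly_eq j := algebraMap_eq_uniformizer_infty _
  mulChar_twistedValue s ω χ hχ := by
    have hiff : (ell s : ℤ) ∣ ∑ j, ((ell s / s j * ω j : ℕ) : ℤ) *
        (-((kummerPoly c f j).natDegree : ℤ)) ↔
        ell s ∣ ∑ j, ell s / s j * ω j * (kummerPoly c f j).natDegree := by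
      rw [← Int.natCast_dvd_natCast]
      simp only [mul_neg, Finset.sum_neg_distrib, dvd_neg]
      push_cast
      rfl
    rw [twistedValue_infty]
    simp only [hiff]
    split_ifs with h
    · rw [mulChar_leadCoeff hχ, Units.coe_prod, map_prod]
      simp only [Units.val_pow_eq_pow_val, map_pow]
    · rw [MulChar.map_zero]

theorem exists_eq_pow_mul_eval_ne_zero {f : F[X]} (hf0 : f ≠ 0) (x : F) :
    ∃ (ε : ℕ) (h : F[X]), f = (X - C x) ^ ε * h ∧ h.eval x ≠ 0 := by
  obtain ⟨h, h1, h2⟩ := exists_eq_pow_rootMultiplicity_mul_and_not_dvd f hf0 x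
  exact ⟨_, h, h1, fun h0 => h2 (dvd_iff_isRoot.2 h0)⟩

/-- Squarefreeness and coprimality leave at most one `f α` vanishing at `x`, and only simply. Hence
the order of the twisted product is `0` or a single exponent `m α`, and there is no cancellation
between factors modulo `ell s`. -/
theorem exists_isLocalData_coe (c : Fin n → Fˣ) {f : IndexSet r → F[X]} (hf : IsAdmissibleTuple f)
    (x : F) : ∃ k g b, IsLocalData c f (OnePoint.some x) k g b := by
  classical
  choose ε h hε hx using fun α => exists_eq_pow_mul_eval_ne_zero (hf.1 α).1.ne_zero x
  have hε1 : ∀ α, ε α ≤ 1 := by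
    intro α
    by_contra h2
    refine (not_isUnit_X_sub_C x) ((hf.1 α).2 (X - C x) ?_)
    rw [hε α, ← pow_two]
    exact Dvd.dvd.mul_right (pow_dvd_pow _ (by omega)) _
  have hdvd : ∀ α, ε α ≠ 0 → X - C x ∣ f α := fun α h0 => by
    rw [hε α]
    exact Dvd.dvd.mul_right (dvd_pow_self _ h0) _
  have huniq : ∀ α β, ε α ≠ 0 → ε β ≠ 0 → α = β := by
    intro α β ha hb
    by_contra hne
    exact (not_isUnit_X_sub_C x) ((hf.2 α β hne).isUnit_of_dvd' (hdvd α ha) (hdvd β hb))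
  let H : IndexSet r → Fˣ := fun α => Units.mk0 _ (hx α)
  let G : Fin n → F[X] := fun j => C (c j : F) * ∏ α : IndexSet r, h α ^ (α.1 j : ℕ)
  refine ⟨fun j => ((∑ α : IndexSet r, ε α * (α.1 j : ℕ) : ℕ) : ℤ),
    fun j => (G j).comp (X + C x), fun j => c j * ∏ α : IndexSet r, H α ^ (α.1 j : ℕ), ?_, ?_, ?_⟩
  · intro j
    simp [G, H, eval_comp, eval_prod]
  · intro j
    rw [aeval_uniformizer_coe, uniformizer_coe, zpow_natCast, ← map_pow, ← map_mul, comp_assoc]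
    congr 1
    have h1 : (X + C x : F[X]).comp (X - C x) = X := by simp
    rw [h1, comp_X, kummerPoly, ← Finset.prod_pow_eq_pow_sum]
    simp only [G]
    rw [mul_left_comm, ← Finset.prod_mul_distrib]
    congr 1
    refine Finset.prod_congr rfl fun α _ => ?_
    conv_lhs => rw [hε α, mul_pow, ← pow_mul]
  · intro s ω χ hχ
    set w : Fin n → ℕ := fun j => ell s / s j * ω j with hw
    set m : IndexSet r → ℕ := fun α => ∑ j, w j * (α.1 j : ℕ) with hm
    have hsum : ∑ j, (w j : ℤ) * ((∑ α : IndexSet r, ε α * (α.1 j : ℕ) : ℕ) : ℤ) =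
        ((∑ α, ε α * m α : ℕ) : ℤ) := by
      push_cast [hm]
      simp only [Finset.mul_sum]
      rw [Finset.sum_comm]
      exact Finset.sum_congr rfl fun α _ => Finset.sum_congr rfl fun j _ => by ring
    have hval : χ (twistedValue c f s ω (OnePoint.some x)) =
        (∏ j, χ (c j) ^ w j) * ∏ α, χ ((f α).eval x) ^ (m α % ell s) := by
      rw [twistedValue_coe, twistedPoly, eval_mul, eval_C, eval_prod, map_mul,
        mulChar_leadCoeff hχ, map_prod]
      simp only [eval_pow, map_pow]
      rfl
    have hiff : ((ell s : ℤ) ∣ ∑ j, ((ell s / s j * ω j : ℕ) : ℤ) *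
        ((∑ α : IndexSet r, ε α * (α.1 j : ℕ) : ℕ) : ℤ)) ↔ ell s ∣ ∑ α, ε α * m α := by
      rw [← Int.natCast_dvd_natCast, ← hsum]
    refine hval.trans (Eq.trans ?_ (if_congr hiff rfl rfl).symm)
    -- If the vanishing factor survives reduction modulo `ell s`, both sides are `0`. Otherwise its
    -- reduced exponent is `0`, so the factor is `1`, and so is the character value of its unit part
    -- raised to `m α`.
    by_cases hram : ∃ α, ε α ≠ 0 ∧ ¬ ell s ∣ m α
    · obtain ⟨α, hα, hmα⟩ := hram
      have h1 : ∑ β, ε β * m β = m α := by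
        rw [Finset.sum_eq_single α]
        · rw [show ε α = 1 by have := hε1 α; omega, one_mul]
        · intro β _ hβ
          have : ε β = 0 := by
            by_contra h0
            exact hβ (huniq β α h0 hα)
          rw [this, zero_mul]
        · exact fun h0 => absurd (Finset.mem_univ _) h0
      rw [h1, if_neg hmα, Finset.prod_eq_zero (Finset.mem_univ α), mul_zero]
      have h2 : (f α).eval x = 0 := dvd_iff_isRoot.1 (hdvd α hα)
      rw [h2, MulChar.map_zero, zero_pow]
      exact fun h0 => hmα (Nat.dvd_of_mod_eq_zero h0)
    · push Not at hram
      have h1 : ell s ∣ ∑ β, ε β * m β := Finset.dvd_sum fun β _ => by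
        by_cases h0 : ε β = 0
        · simp [h0]
        · exact Dvd.dvd.mul_left (hram β h0) _
      rw [if_pos h1]
      have h2 : ∀ α, χ ((f α).eval x) ^ (m α % ell s) = χ (H α) ^ m α := by
        intro α
        by_cases h0 : ε α = 0
        · have h3 : (f α).eval x = H α := by
            rw [hε α, h0]; simp [H]
          rw [h3, mulChar_pow_mod hχ]
        · rw [← mulChar_pow_mod hχ (H α), Nat.mod_eq_zero_of_dvd (hram α h0), pow_zero, pow_zero]
      simp only [h2]
      have h3 : (∏ j, (c j * ∏ α : IndexSet r, H α ^ (α.1 j : ℕ)) ^ w j) =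
          (∏ j, c j ^ w j) * ∏ α, H α ^ m α := by
        simp only [mul_pow, Finset.prod_mul_distrib, ← Finset.prod_pow, ← pow_mul]
        congr 1
        rw [Finset.prod_comm]
        refine Finset.prod_congr rfl fun α _ => ?_
        rw [Finset.prod_pow_eq_pow_sum]
        simp only [hm, mul_comm]
      change _ = χ ((∏ j, (c j * ∏ α : IndexSet r, H α ^ (α.1 j : ℕ)) ^ w j : Fˣ) : F)
      rw [h3, Units.val_mul, Units.coe_prod, Units.coe_prod, map_mul, map_prod, map_prod]
      simp only [Units.val_pow_eq_pow_val, map_pow]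

theorem exists_isLocalData (c : Fin n → Fˣ) {f : IndexSet r → F[X]} (hf : IsAdmissibleTuple f)
    (x : OnePoint F) : ∃ k g b, IsLocalData c f x k g b := by
  induction x using OnePoint.rec with
  | infty => exact ⟨_, _, _, isLocalData_infty c hf⟩
  | coe x => exact exists_isLocalData_coe c hf x

theorem isAdmissibleTuple_of_mem_tuplesBracket {d : IndexSet r → ℕ} {f : IndexSet r → F[X]}
    (hf : f ∈ tuplesBracket F d) : IsAdmissibleTuple f := by
  rcases hf with hf | hf
  · exact hf.1
  · obtain ⟨β, hβ⟩ := Set.mem_iUnion.1 hf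
    exact hβ.1

end LocalData

/-! ### Roots of unity in `F`, and the comparison of both counts over each point. -/

theorem hasEnoughRootsOfUnity_of_dvd_card_sub_one {F : Type*} [Field F] [Fintype F] {N : ℕ}
    (hN : N ∣ Fintype.card F - 1) : HasEnoughRootsOfUnity F N := by
  classical
  have hcard : Fintype.card Fˣ = Fintype.card F - 1 := Fintype.card_units F
  have : NeZero (Fintype.card F - 1) := ⟨by rw [← hcard]; exact Fintype.card_ne_zero⟩
  have : HasEnoughRootsOfUnity F (Fintype.card F - 1) := by
    obtain ⟨g, hg⟩ := IsCyclic.exists_generator (α := Fˣ)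
    have h1 : IsPrimitiveRoot g (Fintype.card F - 1) := by
      rw [IsPrimitiveRoot.iff_orderOf, orderOf_eq_card_of_forall_mem_zpowers hg,
        Nat.card_eq_fintype_card, hcard]
    exact ⟨⟨g, IsPrimitiveRoot.coe_units_iff.2 h1⟩, inferInstance⟩
  exact HasEnoughRootsOfUnity.of_dvd F hN

end AbelianCover

theorem lemma3p2
    -- the finite field with `q` elements
    {F : Type*} [Field F] [Fintype F]
    -- `G = ℤ/r_1 × ⋯ × ℤ/r_n` with `r_j ∣ r_{j+1}` and `q ≡ 1 mod exp(G)`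
    {n : ℕ} (r : Fin n → ℕ) (hr_pos : ∀ j, 0 < r j) (hr_dvd : ∀ i j, i ≤ j → r i ∣ r j)
    (hq : ∀ j, Fintype.card F ≡ 1 [MOD r j])
    -- the degree vector, with `d_j = ∑_α α_j d(α) ≡ 0 mod r_j`
    (d : AbelianCover.IndexSet r → ℕ) (hd : ∀ j, ∑ α, (α.1 j : ℕ) * d α ≡ 0 [MOD r j])
    -- the data `(c, (f_α))`
    (c : Fin n → Fˣ) (f : AbelianCover.IndexSet r → Polynomial F)
    (hf : f ∈ AbelianCover.tuplesBracket F d)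
    -- the function field `L = K(C)` of the curve `C` that corresponds to `(c, (f_α))`
    {L : Type*} [Field L] [Algebra (RatFunc F) L] [Algebra F L] [IsScalarTower F (RatFunc F) L]
    (hL : AbelianCover.CorrespondsTo L c f)
    -- for each relevant `m`, a multiplicative character of order `m` (with value `0` at `0`)
    (χ : ℕ → MulChar F ℂ) (hχ : ∀ m, m ∣ Finset.univ.lcm r → orderOf (χ m) = m) :
    (AbelianCover.rationalPoints F L).Finite ∧
    ((AbelianCover.rationalPoints F L).ncard : ℂ) =
      ∑ x : OnePoint F, ∑ s ∈ AbelianCover.divisorVectors r, ∑ ω ∈ AbelianCover.Omega s,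
        χ (AbelianCover.ell s) (AbelianCover.twistedValue c f s ω x) := by
  classical
  have hlcm : Finset.univ.lcm r = AbelianCover.ell r := rfl
  have hr0 : ∀ j, NeZero (r j) := fun j => ⟨(hr_pos j).ne'⟩
  have hN0 : NeZero (AbelianCover.ell r) := ⟨by
    rw [← hlcm, Ne, Finset.lcm_eq_zero_iff]
    rintro ⟨j, -, h⟩
    exact (hr_pos j).ne' h⟩
  have hroots : HasEnoughRootsOfUnity F (AbelianCover.ell r) :=
    AbelianCover.hasEnoughRootsOfUnity_of_dvd_card_sub_one
      (Finset.lcm_dvd fun j _ => (Nat.modEq_iff_dvd' Fintype.card_pos).1 (hq j).symm)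
  have hadm := AbelianCover.isAdmissibleTuple_of_mem_tuplesBracket hf
  obtain ⟨hgal, ⟨e⟩, y, hy, hgen⟩ := hL
  have hcard : Nat.card (L ≃ₐ[RatFunc F] L) = ∏ j, r j := by
    rw [Nat.card_congr e.toEquiv, Nat.card_congr Multiplicative.toAdd, Nat.card_pi]
    simp
  have : Finite (L ≃ₐ[RatFunc F] L) := Nat.finite_of_card_ne_zero (by
    rw [hcard]; exact Finset.prod_ne_zero_iff.2 fun j _ => (hr_pos j).ne')
  have : FiniteDimensional (RatFunc F) L := IsGalois.finiteDimensional_of_finite _ _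
  have hfinrank : Module.finrank (RatFunc F) L = ∏ j, r j := by
    rw [← IsGalois.card_aut_eq_finrank, hcard]
  choose k g b hdata using fun x => AbelianCover.exists_isLocalData c hadm x
  have hlocal := fun x => AbelianCover.ncard_rationalZeros_of_transcendental (y := y)
    (AbelianCover.transcendental_uniformizer x) (AbelianCover.exists_eq_aeval_uniformizer_div x)
    (hdata x).eval_zero (fun j => by rw [hy j, (hdata x).kummerPoly_eq])
    (AbelianCover.dvd_ell r) hcard hfinrank hgen
  obtain ⟨h1, h2⟩ := AbelianCover.ncard_rationalPoints fun x => (hlocal x).1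
  refine ⟨h1, ?_⟩
  rw [h2, Nat.cast_sum]
  refine Finset.sum_congr rfl fun x _ => ?_
  rw [(hlocal x).2]
  refine Eq.trans (by congr!) ((AbelianCover.sum_mulChar_eq hr_pos χ hχ (b x) (k x)).symm.trans ?_)
  refine Finset.sum_congr rfl fun s hs => Finset.sum_congr rfl fun ω _ => ?_
  exact ((hdata x).mulChar_twistedValue s ω _ (orderOf_dvd_iff_pow_eq_one.1
    (hχ _ (AbelianCover.ell_dvd_ell hs)).dvd)).symm
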